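/- We consider formulas of first-order logic without built-in equality, over a signature with countably many function symbols (constants being $0$-ary functions) and predicate symbols of each arity, and entailment $\models$ over nonempty structures and assignments to the free variables. For a formula $A$ let $\mathrm{var}(A)$ be the set of its free variables and $\mathrm{voc}(A)$ the set of the functions occurring in $A$ together with the pairs $\langle p,\mathit{pol}\rangle$ such that the predicate $p$ occurs in $A$ with polarity $\mathit{pol}\in\{+,-\}$. A Craig-Lyndon interpolant of $F$ and $G$ is a formula $H$ with $F\models H$, $H\models G$, $\mathrm{voc}(H)\subseteq\mathrm{voc}(F)\cap\mathrm{voc}(G)$ and $\mathrm{var}(H)\subseteq\mathrm{var}(F)\cap\mathrm{var}(G)$. A Horn clause is a disjunction of literals (possibly empty, i.e. $\bot$) with at most one positive literal; a Horn formula is built up from Horn clauses with conjunction (including the empty conjunction $\top$), $\exists$ and $\forall$. A clausal tableau for a conjunction $N$ of clauses is a finite ordered tree whose nodes other than the root are labeled with literals, such that for each inner node the disjunction of the labels of its children is an instance of a clause of $N$; it is closed if each branch contains two complementary literals. A clausal tableau proof of $F\models G$ consists of clausal formulas $F'$ and $G'$ and a closed clausal tableau for $F'\wedge G'$ (no tableau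 is needed if $F'$ or $G'$ contains the empty clause), where, with $F_c$ and $G_c$ obtained from $F$ and $G$ by replacing the free variables with dedicated fresh constants, $F'$ and $G'$ are clausal forms of $F_c$ and $\neg G_c$ with disjoint finite sets $\mathcal F'$, $\mathcal G'$ of fresh Skolem functions, i.e. $F_c\equiv\exists\mathcal F'\,\forall\vec u\,F'$, $\neg G_c\equiv\exists\mathcal G'\,\forall\vec v\,G'$, $\mathrm{voc}(F')\subseteq\mathrm{voc}(F_c)\cup\mathcal F'$ and $\mathrm{voc}(G')\subseteq\mathrm{voc}(\neg G_c)\cup\mathcal G'$, with $\vec u$, $\vec v$ the variables of $F'$, $G'$. Theorem (Interpolation from a Horn Formula). Let $F$ be a Horn formula and let $G$ be a formula such that $F\models G$. Then there exists a Craig-Lyndon interpolant $H$ of $F$ and $G$ that is a Horn formula. Moreover, such an $H$ can be effectively constructed from a clausal tableau proof of $F\models G$: there is a partial recursive function on (Gödel numbers of) triples which, for all such $F$, $G$ and every clausal tableau proof $P$ of $F\models G$, is defined on $(F,G,P)$ and yields a Horn formula that is a Craig-Lyndon interpolant of $F$ and $G$. -/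

import Mathlib

namespace HornInterpolation

/-! ## Formulas of first-order logic (without built-in equality) -/

/-- The signature: countably many function symbols and countably many predicate symbols of every
arity (constants are the 0-ary functions). A function or predicate symbol is identified by the
pair of its arity and its name. Formulas being finite, every formula over any signature is, up to
renaming of symbols, a formula over this one. -/
abbrev Sig : FirstOrder.Language.{0, 0} := ⟨fun _ => ℕ, fun _ => ℕ⟩

/-- Terms; variables are natural numbers. -/
abbrev Trm : Type := Sig.Term ℕ

/-- First-order formulas with named variables. -/
inductive Form : Type
  | top : Form
  | bot : Form
  | atom (n : ℕ) (p : ℕ) (ts : Fin n → Trm) : Form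
  | neg (A : Form) : Form
  | and (A B : Form) : Form
  | or (A B : Form) : Form
  | imp (A B : Form) : Form
  | all (x : ℕ) (A : Form) : Form
  | ex (x : ℕ) (A : Form) : Form

/-! ### Semantics -/

/-- The value of a term in the structure `S` under the assignment `v`. -/
def termVal {M : Type} (S : Sig.Structure M) (v : ℕ → M) (t : Trm) : M :=
  @FirstOrder.Language.Term.realize Sig M S ℕ v t

/-- Truth of an atom in the structure `S` under the assignment `v`. -/
def AtomSat {M : Type} (S : Sig.Structure M) (v : ℕ → M) (n p : ℕ) (ts : Fin n → Trm) : Prop :=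
  @FirstOrder.Language.Structure.RelMap Sig M S n p (fun i => termVal S v (ts i))

/-- Truth of a formula in the structure `S` under the assignment `v`. -/
def Form.Sat {M : Type} (S : Sig.Structure M) : (ℕ → M) → Form → Prop
  | _, .top => True
  | _, .bot => False
  | v, .atom n p ts => AtomSat S v n p ts
  | v, .neg A => ¬ A.Sat S v
  | v, .and A B => A.Sat S v ∧ B.Sat S v
  | v, .or A B => A.Sat S v ∨ B.Sat S v
  | v, .imp A B => A.Sat S v → B.Sat S v
  | v, .all x A => ∀ a : M, A.Sat S (Function.update v x a)
  | v, .ex x A => ∃ a : M, A.Sat S (Function.update v x a)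

/-- Semantic entailment, over all nonempty structures and all assignments to the variables. -/
def Entails (A B : Form) : Prop :=
  ∀ (M : Type) [Nonempty M] (S : Sig.Structure M) (v : ℕ → M), A.Sat S v → B.Sat S v

/-! ### Variables and vocabulary -/

/-- The functions (arity and name) occurring in a term. -/
def termFuns : Trm → Set (ℕ × ℕ)
  | .var _ => ∅
  | .func (l := n) f ts => insert (n, f) (⋃ i, termFuns (ts i))

/-- The functions occurring in a formula. -/
def Form.funs : Form → Set (ℕ × ℕ)
  | .top => ∅
  | .bot => ∅
  | .atom _ _ ts => ⋃ i, termFuns (ts i)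
  | .neg A => A.funs
  | .and A B => A.funs ∪ B.funs
  | .or A B => A.funs ∪ B.funs
  | .imp A B => A.funs ∪ B.funs
  | .all _ A => A.funs
  | .ex _ A => A.funs

/-- The free variables of a formula. -/
def Form.freeVars : Form → Set ℕ
  | .top => ∅
  | .bot => ∅
  | .atom _ _ ts => ⋃ i, ((ts i).varFinset : Set ℕ)
  | .neg A => A.freeVars
  | .and A B => A.freeVars ∪ B.freeVars
  | .or A B => A.freeVars ∪ B.freeVars
  | .imp A B => A.freeVars ∪ B.freeVars
  | .all x A => A.freeVars \ {x}
  | .ex x A => A.freeVars \ {x}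

/-- The predicates (arity and name) occurring in a formula, paired with the polarity of an
occurrence (`true` is positive), when the formula itself stands in a context of polarity `pol`. -/
def Form.predsAt : Bool → Form → Set ((ℕ × ℕ) × Bool)
  | _, .top => ∅
  | _, .bot => ∅
  | pol, .atom n p _ => {((n, p), pol)}
  | pol, .neg A => A.predsAt (!pol)
  | pol, .and A B => A.predsAt pol ∪ B.predsAt pol
  | pol, .or A B => A.predsAt pol ∪ B.predsAt pol
  | pol, .imp A B => A.predsAt (!pol) ∪ B.predsAt pol
  | pol, .all _ A => A.predsAt pol
  | pol, .ex _ A => A.predsAt pol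

/-- A vocabulary consists of functions and of predicates with a polarity. -/
abbrev Vocab : Type := Set ((ℕ × ℕ) ⊕ ((ℕ × ℕ) × Bool))

/-- The vocabulary of a formula: its functions, and its predicates with their polarities. -/
def Form.voc (A : Form) : Vocab := Sum.inl '' A.funs ∪ Sum.inr '' A.predsAt true

/-- `H` is a Craig-Lyndon interpolant of `F` and `G`. -/
structure IsCraigLyndonInterpolant (F G H : Form) : Prop where
  left : Entails F H
  right : Entails H G
  voc : H.voc ⊆ F.voc ∩ G.voc
  vars : H.freeVars ⊆ F.freeVars ∩ G.freeVars

/-! ### Horn formulas -/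

/-- The formula is a clause: a (possibly empty) disjunction of literals. -/
def Form.IsClause : Form → Prop
  | .bot => True
  | .atom _ _ _ => True
  | .neg (.atom _ _ _) => True
  | .or A B => A.IsClause ∧ B.IsClause
  | _ => False

/-- The number of positive literals of a clause. -/
def Form.numPos : Form → ℕ
  | .atom _ _ _ => 1
  | .or A B => A.numPos + B.numPos
  | _ => 0

/-- Horn formulas: built up from Horn clauses (clauses with at most one positive literal) with
conjunction (the empty conjunction `⊤` included) and quantification. -/
inductive Form.IsHorn : Form → Prop
  | clause (C : Form) : C.IsClause → C.numPos ≤ 1 → C.IsHorn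
  | top : Form.IsHorn .top
  | and (A B : Form) : A.IsHorn → B.IsHorn → (Form.and A B).IsHorn
  | all (x : ℕ) (A : Form) : A.IsHorn → (Form.all x A).IsHorn
  | ex (x : ℕ) (A : Form) : A.IsHorn → (Form.ex x A).IsHorn

/-! ## Clausal formulas and clausal tableaux -/

/-- A literal: the atom `p(ts)` if `pos` is `true`, and its negation otherwise. -/
structure Lit : Type where
  pos : Bool
  arity : ℕ
  pred : ℕ
  args : Fin arity → Trm

/-- The complement of a literal. -/
def Lit.compl (L : Lit) : Lit := { L with pos := !L.pos }

/-- The instance of a literal under a substitution. -/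
def Lit.subst (s : ℕ → Trm) (L : Lit) : Lit := { L with args := fun i => (L.args i).subst s }

/-- The vocabulary of a literal. -/
def Lit.voc (L : Lit) : Vocab :=
  Sum.inl '' (⋃ i, termFuns (L.args i)) ∪ {Sum.inr ((L.arity, L.pred), L.pos)}

/-- Truth of a literal. -/
def Lit.Sat {M : Type} (S : Sig.Structure M) (v : ℕ → M) (L : Lit) : Prop :=
  if L.pos = true then AtomSat S v L.arity L.pred L.args
  else ¬ AtomSat S v L.arity L.pred L.args

/-- A clause as the list of its literals. -/
abbrev Clause : Type := List Lit

/-- A clausal formula as the list of its clauses. -/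
abbrev Clauses : Type := List Clause

/-- The vocabulary of a clausal formula. -/
def clausesVoc (N : Clauses) : Vocab := {s | ∃ C ∈ N, ∃ L ∈ C, s ∈ L.voc}

/-- Truth of the universal closure of a clausal formula. -/
def ClausesSat {M : Type} (S : Sig.Structure M) (N : Clauses) : Prop :=
  ∀ v : ℕ → M, ∀ C ∈ N, ∃ L ∈ C, L.Sat S v

/-- Finite ordered trees whose nodes, the root excepted, are labeled with literals, given by the
sequence of the children of the root: `nil` is the empty sequence, and `cons L sub rest` is the
sequence whose first child has the label `L` and the sequence `sub` of children of its own, and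
whose other children are `rest`. -/
inductive Tableau : Type
  | nil : Tableau
  | cons (L : Lit) (sub rest : Tableau) : Tableau

/-- The labels of the children of the root, from left to right. -/
def Tableau.labels : Tableau → List Lit
  | .nil => []
  | .cons L _ rest => L :: rest.labels

/-- A node with these children is a leaf, or the disjunction of the labels of its children is an
instance of a clause of `N`. -/
def Tableau.NodeOK (N : Clauses) (T : Tableau) : Prop :=
  T = .nil ∨ ∃ C ∈ N, ∃ s : ℕ → Trm, T.labels = C.map (Lit.subst s)

/-- Every proper descendant of the root satisfies the condition `NodeOK`. -/
def Tableau.DescendantsOK (N : Clauses) : Tableau → Prop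
  | .nil => True
  | .cons _ sub rest => sub.NodeOK N ∧ sub.DescendantsOK N ∧ rest.DescendantsOK N

/-- `T` is a clausal tableau for the clausal formula `N`. -/
def Tableau.IsFor (N : Clauses) (T : Tableau) : Prop := T.NodeOK N ∧ T.DescendantsOK N

/-- The branches (from the root to a leaf) that pass through a child of the root, each given by
the list of its literals. -/
def Tableau.branches : Tableau → List (List Lit)
  | .nil => []
  | .cons L .nil rest => [L] :: rest.branches
  | .cons L (.cons K sub sibs) rest =>
      ((Tableau.cons K sub sibs).branches.map (fun b => L :: b)) ++ rest.branches

/-- A tableau is closed if each of its branches contains complementary literals. The tableau that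
consists just of the root has a single branch, without literals, and is not closed. -/
def Tableau.Closed (T : Tableau) : Prop :=
  T ≠ .nil ∧ ∀ b ∈ T.branches, ∃ L ∈ b, L.compl ∈ b

/-! ## Clausal tableau proofs of entailments -/

/-- Substitution for the free occurrences of variables. It is used only with closed terms. -/
def Form.substFree : (ℕ → Trm) → Form → Form
  | _, .top => .top
  | _, .bot => .bot
  | s, .atom n p ts => .atom n p (fun i => (ts i).subst s)
  | s, .neg A => .neg (A.substFree s)
  | s, .and A B => .and (A.substFree s) (B.substFree s)
  | s, .or A B => .or (A.substFree s) (B.substFree s)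
  | s, .imp A B => .imp (A.substFree s) (B.substFree s)
  | s, .all x A => .all x (A.substFree (Function.update s x (FirstOrder.Language.Term.var x)))
  | s, .ex x A => .ex x (A.substFree (Function.update s x (FirstOrder.Language.Term.var x)))

/-- The constant with name `c`. -/
def const (c : ℕ) : Trm := FirstOrder.Language.Term.func (L := Sig) (l := 0) c Fin.elim0

/-- Replace each free variable `x` by the constant `c x`. -/
def Form.close (c : ℕ → ℕ) (A : Form) : Form := A.substFree (fun x => const (c x))

/-- The structures agree on all predicates and on all functions outside of `K`. -/
def AgreeOff {M : Type} (K : Finset (ℕ × ℕ)) (S R : Sig.Structure M) : Prop :=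
  (∀ (n p : ℕ) (xs : Fin n → M),
    @FirstOrder.Language.Structure.RelMap Sig M S n p xs ↔ @FirstOrder.Language.Structure.RelMap Sig M R n p xs) ∧
  (∀ (n f : ℕ) (xs : Fin n → M), (n, f) ∉ K →
    @FirstOrder.Language.Structure.funMap Sig M S n f xs = @FirstOrder.Language.Structure.funMap Sig M R n f xs)

/-- `N` is a clausal form of the sentence `A` with the Skolem functions `K`: `A` is equivalent
to the second-order formula `∃ K ∀ u N`, where `u` are the variables of `N`, and the vocabulary
of `N` is that of `A` extended by `K`. -/
structure IsClausalForm (K : Finset (ℕ × ℕ)) (A : Form) (N : Clauses) : Prop where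
  equiv : ∀ (M : Type) [Nonempty M] (S : Sig.Structure M) (v : ℕ → M),
    A.Sat S v ↔ ∃ R : Sig.Structure M, AgreeOff K S R ∧ ClausesSat R N
  voc : clausesVoc N ⊆ A.voc ∪ Sum.inl '' (K : Set (ℕ × ℕ))

/-- The data of a clausal tableau proof: the clausal forms of the antecedent and of the negated
consequent, and a tableau. -/
structure TableauProof : Type where
  left : Clauses
  right : Clauses
  tableau : Tableau

/-- `P` is a clausal tableau proof of the entailment of `G` by `F`: after replacing the free
variables of `F` and `G` by dedicated fresh constants (`c x` for `x`), `P.left` and `P.right`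
are clausal forms of `F` and of the negation of `G` with disjoint sets of fresh Skolem functions,
and `P.tableau` is a closed clausal tableau for `P.left ∧ P.right`. No tableau is needed in the
trivial case that one of the clausal forms contains the empty clause. -/
def TableauProof.Proves (P : TableauProof) (F G : Form) : Prop :=
  ∃ (c : ℕ → ℕ) (KF KG : Finset (ℕ × ℕ)),
    Set.InjOn c (F.freeVars ∪ G.freeVars) ∧
    (∀ x ∈ F.freeVars ∪ G.freeVars, (0, c x) ∉ F.funs ∪ G.funs) ∧
    Disjoint KF KG ∧
    Disjoint ((KF ∪ KG : Finset (ℕ × ℕ)) : Set (ℕ × ℕ)) ((F.close c).funs ∪ (G.close c).funs) ∧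
    IsClausalForm KF (F.close c) P.left ∧
    IsClausalForm KG (.neg (G.close c)) P.right ∧
    ([] ∈ P.left ∨ [] ∈ P.right ∨
      (P.tableau.IsFor (P.left ++ P.right) ∧ P.tableau.Closed))

/-! ## Gödel numbers -/

/-- Gödel numbers of terms. -/
def termCode : Trm → ℕ
  | .var x => Nat.pair 0 x
  | .func f ts => Nat.pair 1 (Nat.pair f (Encodable.encode (List.ofFn fun i => termCode (ts i))))

/-- Gödel numbers of argument tuples. -/
def argsCode {n : ℕ} (ts : Fin n → Trm) : ℕ :=
  Encodable.encode (List.ofFn fun i => termCode (ts i))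

/-- Gödel numbers of formulas. -/
def Form.code : Form → ℕ
  | .top => Nat.pair 0 0
  | .bot => Nat.pair 1 0
  | .atom _ p ts => Nat.pair 2 (Nat.pair p (argsCode ts))
  | .neg A => Nat.pair 3 A.code
  | .and A B => Nat.pair 4 (Nat.pair A.code B.code)
  | .or A B => Nat.pair 5 (Nat.pair A.code B.code)
  | .imp A B => Nat.pair 6 (Nat.pair A.code B.code)
  | .all x A => Nat.pair 7 (Nat.pair x A.code)
  | .ex x A => Nat.pair 8 (Nat.pair x A.code)

/-- Gödel numbers of literals. -/
def Lit.code (L : Lit) : ℕ := Nat.pair L.pos.toNat (Nat.pair L.pred (argsCode L.args))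

/-- Gödel numbers of clausal formulas. -/
def clausesCode (N : Clauses) : ℕ := Encodable.encode (N.map fun C => C.map Lit.code)

/-- Gödel numbers of tableaux. -/
def Tableau.code : Tableau → ℕ
  | .nil => 0
  | .cons L sub rest => Nat.pair L.code (Nat.pair sub.code rest.code) + 1

/-- Gödel numbers of tableau proofs. -/
def TableauProof.code (P : TableauProof) : ℕ :=
  Nat.pair (clausesCode P.left) (Nat.pair (clausesCode P.right) P.tableau.code)

end HornInterpolation

open HornInterpolation

namespace HornInterpolation

open FirstOrder.Language

/-! ## Ground terms and ground atoms -/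

/-- The ground term for a free variable. -/
def parT (x : ℕ) : ℕ := Nat.pair 0 x

/-- The ground term with function `f` and the given arguments. -/
def fnT (f : ℕ) (ts : List ℕ) : ℕ := Nat.pair 1 (Nat.pair f (Encodable.encode ts))

/-- The Skolem term for the quantifier on `x` of a formula with matrix code `c` under the
environment `σ`; `s` tells the side and `e` the polarity in which the formula is skolemized. -/
def epsT (s e : Bool) (x c : ℕ) (σ : List (ℕ × ℕ)) : ℕ :=
  Nat.pair 2 (Nat.pair s.toNat (Nat.pair e.toNat (Nat.pair x (Nat.pair c (Encodable.encode σ)))))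

/-- The ground term assigned to a variable by an environment. -/
def look (σ : List (ℕ × ℕ)) (x : ℕ) : ℕ := (σ.lookup x).getD (parT x)

theorem look_nil : look [] = parT := by
  funext x; simp [look]

theorem look_cons (x u : ℕ) (σ : List (ℕ × ℕ)) :
    look ((x, u) :: σ) = Function.update (look σ) x u := by
  funext y
  by_cases h : y = x
  · subst h; simp [look]
  · have : (y == x) = false := by simpa using h
    simp [look, List.lookup_cons, this, Function.update_of_ne h]

/-- The ground instance of a term. -/
def inst (σ : List (ℕ × ℕ)) : Trm → ℕ
  | .var x => look σ x
  | .func (l := n) f ts => fnT f (List.ofFn fun i : Fin n => inst σ (ts i))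

/-- Ground atoms: a predicate name and the arguments. -/
abbrev GAtom : Type := ℕ × List ℕ

/-- The ground instance of an atom. -/
def instAtom (σ : List (ℕ × ℕ)) {n : ℕ} (p : ℕ) (ts : Fin n → Trm) : GAtom :=
  (p, List.ofFn fun i => inst σ (ts i))

/-- Truth under the valuation `J` of the skolemized expansion of a formula. In positive polarity
(`e = true`) existential quantifiers are skolemized and universal ones are expanded over `U`; in
negative polarity the roles are exchanged. -/
def Form.ev (s : Bool) (U : List ℕ) (J : GAtom → Bool) : Bool → List (ℕ × ℕ) → Form → Prop
  | _, _, .top => True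
  | _, _, .bot => False
  | _, σ, .atom _ p ts => J (instAtom σ p ts) = true
  | e, σ, .neg A => ¬ A.ev s U J (!e) σ
  | e, σ, .and A B => A.ev s U J e σ ∧ B.ev s U J e σ
  | e, σ, .or A B => A.ev s U J e σ ∨ B.ev s U J e σ
  | e, σ, .imp A B => A.ev s U J (!e) σ → B.ev s U J e σ
  | true, σ, .all x A => ∀ u ∈ U, A.ev s U J true ((x, u) :: σ)
  | false, σ, .all x A => A.ev s U J false ((x, epsT s false x A.code σ) :: σ)
  | true, σ, .ex x A => A.ev s U J true ((x, epsT s true x A.code σ) :: σ)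
  | false, σ, .ex x A => ∃ u ∈ U, A.ev s U J false ((x, u) :: σ)

/-- The list is used only for conjunctions in positive and disjunctions in negative polarity, and
negation exchanges the two. This allows lists obtained for different subformulas to be merged by
appending. -/
theorem Form.ev_antitone (s : Bool) {U U' : List ℕ} (h : U ⊆ U') (J : GAtom → Bool) (A : Form) :
    ∀ σ, (A.ev s U' J true σ → A.ev s U J true σ) ∧
      (A.ev s U J false σ → A.ev s U' J false σ) := by
  induction A with
  | top | bot | atom => intro σ; simp [Form.ev]
  | neg A ih => intro σ; have := ih σ; simp only [Form.ev, Bool.not_true, Bool.not_false]; tauto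
  | and A B ihA ihB => intro σ; have := ihA σ; have := ihB σ; simp only [Form.ev]; tauto
  | or A B ihA ihB => intro σ; have := ihA σ; have := ihB σ; simp only [Form.ev]; tauto
  | imp A B ihA ihB =>
    intro σ; have := ihA σ; have := ihB σ
    simp only [Form.ev, Bool.not_true, Bool.not_false]; tauto
  | all x A ih =>
    intro σ
    simp only [Form.ev]
    exact ⟨fun H u hu => (ih _).1 (H u (h hu)), (ih _).2⟩
  | ex x A ih =>
    intro σ
    simp only [Form.ev]
    exact ⟨(ih _).1, fun ⟨u, hu, H⟩ => ⟨u, h hu, (ih _).2 H⟩⟩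

/-! ## Herbrand's theorem -/

/-- The Herbrand structure of a valuation. -/
@[reducible]
def herbrand (J : GAtom → Bool) : Sig.Structure ℕ where
  funMap := fun {_} f ts => fnT f (List.ofFn ts)
  RelMap := fun {_} p ts => J (p, List.ofFn ts) = true

theorem termVal_herbrand (J : GAtom → Bool) (σ : List (ℕ × ℕ)) (t : Trm) :
    termVal (herbrand J) (look σ) t = inst σ t := by
  induction t with
  | var x => rfl
  | func f ts ih =>
    have : termVal (herbrand J) (look σ) (.func f ts)
        = fnT f (List.ofFn fun i => termVal (herbrand J) (look σ) (ts i)) := rfl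
    rw [this]; simp only [ih]; rfl

/-- Skolem terms are elements of the Herbrand structure and serve as witnesses. Lists found for two
subformulas are appended, and `Form.ev_antitone` makes the result serve both. -/
theorem Form.sat_herbrand (s : Bool) (J : GAtom → Bool) (A : Form) :
    ∀ σ, ((∀ U, A.ev s U J true σ) → A.Sat (herbrand J) (look σ)) ∧
      (A.Sat (herbrand J) (look σ) → ∃ U, A.ev s U J false σ) := by
  induction A with
  | top => intro σ; simp [Form.ev, Form.Sat]
  | bot => intro σ; simp [Form.ev, Form.Sat]
  | atom n p ts =>
    intro σ
    have : AtomSat (herbrand J) (look σ) n p ts ↔ J (instAtom σ p ts) = true := by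
      change J (p, List.ofFn fun i => termVal (herbrand J) (look σ) (ts i)) = true ↔ _
      simp only [termVal_herbrand]; rfl
    simp [Form.ev, Form.Sat, this]
  | neg A ih =>
    intro σ
    obtain ⟨h1, h2⟩ := ih σ
    simp only [Form.ev, Form.Sat, Bool.not_true, Bool.not_false]
    refine ⟨fun H hA => ?_, fun H => ?_⟩
    · obtain ⟨U, hU⟩ := h2 hA
      exact H U hU
    · by_contra! hc
      exact H (h1 hc)
  | and A B ihA ihB =>
    intro σ
    obtain ⟨a1, a2⟩ := ihA σ
    obtain ⟨b1, b2⟩ := ihB σ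
    simp only [Form.ev, Form.Sat]
    refine ⟨fun H => ⟨a1 fun U => (H U).1, b1 fun U => (H U).2⟩, fun H => ?_⟩
    obtain ⟨U, hU⟩ := a2 H.1
    obtain ⟨V, hV⟩ := b2 H.2
    exact ⟨U ++ V, (Form.ev_antitone s (by simp) J A σ).2 hU,
      (Form.ev_antitone s (by simp) J B σ).2 hV⟩
  | or A B ihA ihB =>
    intro σ
    obtain ⟨a1, a2⟩ := ihA σ
    obtain ⟨b1, b2⟩ := ihB σ
    simp only [Form.ev, Form.Sat]
    refine ⟨fun H => ?_, fun H => ?_⟩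
    · by_contra! hc
      have hA : ∃ U, ¬ A.ev s U J true σ := by by_contra! h; exact hc.1 (a1 h)
      have hB : ∃ U, ¬ B.ev s U J true σ := by by_contra! h; exact hc.2 (b1 h)
      obtain ⟨U, hU⟩ := hA
      obtain ⟨V, hV⟩ := hB
      rcases H (U ++ V) with h | h
      · exact hU ((Form.ev_antitone s (by simp) J A σ).1 h)
      · exact hV ((Form.ev_antitone s (by simp) J B σ).1 h)
    · rcases H with h | h
      · exact (a2 h).imp fun U hU => Or.inl hU
      · exact (b2 h).imp fun U hU => Or.inr hU
  | imp A B ihA ihB =>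
    intro σ
    obtain ⟨a1, a2⟩ := ihA σ
    obtain ⟨b1, b2⟩ := ihB σ
    simp only [Form.ev, Form.Sat, Bool.not_true, Bool.not_false]
    refine ⟨fun H hA => ?_, fun H => ?_⟩
    · by_contra hc
      have hB : ∃ U, ¬ B.ev s U J true σ := by by_contra! h; exact hc (b1 h)
      obtain ⟨U, hU⟩ := a2 hA
      obtain ⟨V, hV⟩ := hB
      exact hV ((Form.ev_antitone s (by simp) J B σ).1
        (H (U ++ V) ((Form.ev_antitone s (by simp) J A σ).2 hU)))
    · by_cases hB : B.Sat (herbrand J) (look σ)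
      · exact (b2 hB).imp fun U hU _ => hU
      · have : ∃ U, ¬ A.ev s U J true σ := by by_contra! h; exact hB (H (a1 h))
        exact this.imp fun U hU h => absurd h hU
  | all x A ih =>
    intro σ
    simp only [Form.ev, Form.Sat, ← look_cons]
    refine ⟨fun H u => (ih _).1 fun U => ?_, fun H => (ih _).2 (H _)⟩
    -- Putting `u` on the list makes its instance available; the list is then shrunk back to `U`.
    exact (Form.ev_antitone s (by simp) J A _).1 (H (u :: U) u (by simp))
  | ex x A ih =>
    intro σ
    simp only [Form.ev, Form.Sat, ← look_cons]
    refine ⟨fun H => ⟨_, (ih _).1 H⟩, fun ⟨u, H⟩ => ?_⟩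
    obtain ⟨U, hU⟩ := (ih _).2 H
    exact ⟨u :: U, u, by simp, (Form.ev_antitone s (by simp) J A _).2 hU⟩

/-- An expansion is a finite Boolean combination of coordinates of `J`. Clopenness is the form in
which the compactness argument uses this. -/
theorem Form.isClopen_ev (s : Bool) (U : List ℕ) (A : Form) :
    ∀ e σ, IsClopen {J : GAtom → Bool | A.ev s U J e σ} := by
  induction A with
  | top => intro e σ; simpa [Form.ev] using isClopen_univ
  | bot => intro e σ; simpa [Form.ev] using isClopen_empty
  | atom n p ts =>
    intro e σ
    exact (isClopen_discrete {true}).preimage (continuous_apply (instAtom σ p ts))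
  | neg A ih =>
    intro e σ
    simp only [Form.ev]
    exact (ih (!e) σ).compl
  | and A B ihA ihB => intro e σ; simp only [Form.ev]; exact (ihA e σ).inter (ihB e σ)
  | or A B ihA ihB => intro e σ; simp only [Form.ev]; exact (ihA e σ).union (ihB e σ)
  | imp A B ihA ihB =>
    intro e σ
    simp only [Form.ev, imp_iff_not_or]
    exact (ihA (!e) σ).compl.union (ihB e σ)
  | all x A ih =>
    intro e σ
    cases e
    · simp only [Form.ev]; exact ih _ _
    · have : {J : GAtom → Bool | (Form.all x A).ev s U J true σ}
          = ⋂ u ∈ {u | u ∈ U}, {J | A.ev s U J true ((x, u) :: σ)} := by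
        ext J; simp [Form.ev]
      rw [this]
      exact (List.finite_toSet U).isClopen_biInter fun u _ => ih _ _
  | ex x A ih =>
    intro e σ
    cases e
    · have : {J : GAtom → Bool | (Form.ex x A).ev s U J false σ}
          = ⋃ u ∈ {u | u ∈ U}, {J | A.ev s U J false ((x, u) :: σ)} := by
        ext J; simp [Form.ev]
      rw [this]
      exact (List.finite_toSet U).isClopen_biUnion fun u _ => ih _ _
    · simp only [Form.ev]; exact ih _ _

/-- If `F` entails `G`, then some finite skolemized expansions of `F` and `¬ G` are jointly
unsatisfiable. -/
theorem Entails.exists_expansion {F G : Form} (h : Entails F G) :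
    ∃ U : List ℕ, ∀ J : GAtom → Bool, F.ev true U J true [] → G.ev false U J false [] := by
  by_contra! hc
  -- By assumption each list has a refuting valuation. The sets of these are closed in a compact
  -- space and directed under appending, so one valuation refutes all lists; its Herbrand structure
  -- will contradict `h`.
  have key : (⋂ U : List ℕ, {J : GAtom → Bool | F.ev true U J true []} ∩
      {J | G.ev false U J false []}ᶜ).Nonempty := by
    refine IsCompact.nonempty_iInter_of_directed_nonempty_isCompact_isClosed _ ?_ ?_ ?_ ?_
    · intro U V
      refine ⟨U ++ V, fun J hJ => ⟨?_, ?_⟩, fun J hJ => ⟨?_, ?_⟩⟩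
      · exact (Form.ev_antitone true (by simp) J F []).1 hJ.1
      · exact fun hG => hJ.2 ((Form.ev_antitone false (by simp) J G []).2 hG)
      · exact (Form.ev_antitone true (by simp) J F []).1 hJ.1
      · exact fun hG => hJ.2 ((Form.ev_antitone false (by simp) J G []).2 hG)
    · intro U
      obtain ⟨J, hJ⟩ := hc U
      exact ⟨J, hJ.1, hJ.2⟩
    · intro U
      exact ((F.isClopen_ev true U true []).inter
        (G.isClopen_ev false U false []).compl).isClosed.isCompact
    · intro U
      exact ((F.isClopen_ev true U true []).inter
        (G.isClopen_ev false U false []).compl).isClosed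
  obtain ⟨J, hJ⟩ := key
  rw [Set.mem_iInter] at hJ
  have hF := (F.sat_herbrand true J []).1 fun U => (hJ U).1
  obtain ⟨U, hU⟩ := (G.sat_herbrand false J []).2 (h ℕ (herbrand J) _ hF)
  exact (hJ U).2 hU

/-- The truth of an expansion depends on finitely many ground atoms only. -/
theorem Form.ev_congr_of_finite (s : Bool) (U : List ℕ) (A : Form) :
    ∀ e σ, ∃ L : List GAtom, ∀ J J' : GAtom → Bool, (∀ q ∈ L, J q = J' q) →
      (A.ev s U J e σ ↔ A.ev s U J' e σ) := by
  induction A with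
  | top | bot => intro e σ; exact ⟨[], fun J J' _ => by simp [Form.ev]⟩
  | atom n p ts =>
    intro e σ
    exact ⟨[instAtom σ p ts], fun J J' h => by simp [Form.ev, h (instAtom σ p ts) (by simp)]⟩
  | neg A ih =>
    intro e σ
    obtain ⟨L, hL⟩ := ih (!e) σ
    exact ⟨L, fun J J' h => by simp only [Form.ev, hL J J' h]⟩
  | and A B ihA ihB | or A B ihA ihB =>
    intro e σ
    obtain ⟨L, hL⟩ := ihA e σ
    obtain ⟨L', hL'⟩ := ihB e σ
    exact ⟨L ++ L', fun J J' h => by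
      simp only [Form.ev, hL J J' fun q hq => h q (by simp [hq]),
        hL' J J' fun q hq => h q (by simp [hq])]⟩
  | imp A B ihA ihB =>
    intro e σ
    obtain ⟨L, hL⟩ := ihA (!e) σ
    obtain ⟨L', hL'⟩ := ihB e σ
    exact ⟨L ++ L', fun J J' h => by
      simp only [Form.ev, hL J J' fun q hq => h q (by simp [hq]),
        hL' J J' fun q hq => h q (by simp [hq])]⟩
  | all x A ih =>
    intro e σ
    cases e
    · exact ih false ((x, epsT s false x A.code σ) :: σ)
    · choose L hL using fun u => ih true ((x, u) :: σ)
      refine ⟨U.flatMap L, fun J J' h => ?_⟩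
      simp only [Form.ev]
      exact forall₂_congr fun u hu => hL u J J' fun q hq => h q (List.mem_flatMap.2 ⟨u, hu, hq⟩)
  | ex x A ih =>
    intro e σ
    cases e
    · choose L hL using fun u => ih false ((x, u) :: σ)
      refine ⟨U.flatMap L, fun J J' h => ?_⟩
      simp only [Form.ev]
      exact exists_congr fun u => and_congr_right fun hu =>
        hL u J J' fun q hq => h q (List.mem_flatMap.2 ⟨u, hu, hq⟩)
    · exact ih true ((x, epsT s true x A.code σ) :: σ)

/-! ## Propositional interpolation -/

/-- Monotonicity of the expansion with respect to the polarities of the predicates. -/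
theorem Form.ev_mono (s : Bool) (U : List ℕ) (A : Form) :
    ∀ (pol e : Bool) (σ : List (ℕ × ℕ)) (J K : GAtom → Bool),
      (∀ q : GAtom, ((q.2.length, q.1), true) ∈ A.predsAt pol → J q = true → K q = true) →
      (∀ q : GAtom, ((q.2.length, q.1), false) ∈ A.predsAt pol → K q = true → J q = true) →
      (pol = true → A.ev s U J e σ → A.ev s U K e σ) ∧
      (pol = false → A.ev s U K e σ → A.ev s U J e σ) := by
  induction A with
  | top | bot => intro pol e σ J K _ _; simp [Form.ev]
  | atom n p ts =>
    intro pol e σ J K h1 h2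
    have e1 := h1 (instAtom σ p ts)
    have e2 := h2 (instAtom σ p ts)
    simp only [Form.predsAt, instAtom, List.length_ofFn] at e1 e2
    constructor
    · rintro rfl; simpa [Form.ev, instAtom] using e1
    · rintro rfl; simpa [Form.ev, instAtom] using e2
  | neg A ih =>
    intro pol e σ J K h1 h2
    obtain ⟨i1, i2⟩ := ih (!pol) (!e) σ J K h1 h2
    simp only [Form.ev]
    cases pol <;> simp at i1 i2 ⊢ <;> tauto
  | and A B ihA ihB | or A B ihA ihB =>
    intro pol e σ J K h1 h2
    simp only [Form.predsAt, Set.mem_union] at h1 h2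
    have i := ihA pol e σ J K (fun q hq => h1 q (.inl hq)) (fun q hq => h2 q (.inl hq))
    have j := ihB pol e σ J K (fun q hq => h1 q (.inr hq)) (fun q hq => h2 q (.inr hq))
    simp only [Form.ev]
    tauto
  | imp A B ihA ihB =>
    intro pol e σ J K h1 h2
    simp only [Form.predsAt, Set.mem_union] at h1 h2
    have i := ihA (!pol) (!e) σ J K (fun q hq => h1 q (.inl hq)) (fun q hq => h2 q (.inl hq))
    have j := ihB pol e σ J K (fun q hq => h1 q (.inr hq)) (fun q hq => h2 q (.inr hq))
    simp only [Form.ev]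
    cases pol <;> simp at i j ⊢ <;> tauto
  | all x A ih =>
    intro pol e σ J K h1 h2
    have i := fun e σ => ih pol e σ J K h1 h2
    cases e
    · exact i _ _
    · simp only [Form.ev]
      exact ⟨fun hp H u hu => (i _ _).1 hp (H u hu), fun hp H u hu => (i _ _).2 hp (H u hu)⟩
  | ex x A ih =>
    intro pol e σ J K h1 h2
    have i := fun e σ => ih pol e σ J K h1 h2
    cases e
    · simp only [Form.ev]
      exact ⟨fun hp ⟨u, hu, H⟩ => ⟨u, hu, (i _ _).1 hp H⟩,
        fun hp ⟨u, hu, H⟩ => ⟨u, hu, (i _ _).2 hp H⟩⟩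
    · exact i _ _

/-! ### Intersections of valuations. -/

open Classical in
/-- The intersection of a set of valuations. -/
noncomputable def interVal (X : Set (GAtom → Bool)) : GAtom → Bool :=
  fun q => decide (∀ J ∈ X, J q = true)

theorem interVal_eq_true {X : Set (GAtom → Bool)} {q : GAtom} :
    interVal X q = true ↔ ∀ J ∈ X, J q = true := by
  simp [interVal]

/-- If a clause fails in the intersection, its negated atoms hold in every member, and a positive
atom fails in some member. With at most one positive literal, that single member falsifies the whole
clause. The sharper statement for no positive literals is needed at disjunctions, where only one
disjunct may choose the member. -/
theorem Form.IsClause.ev_interVal (s : Bool) (U : List ℕ) (X : Set (GAtom → Bool))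
    (hX : X.Nonempty) (e : Bool) (σ : List (ℕ × ℕ)) (C : Form) (hC : C.IsClause)
    (hF : ¬ C.ev s U (interVal X) e σ) :
    (C.numPos = 0 → ∀ J ∈ X, ¬ C.ev s U J e σ) ∧
      (C.numPos ≤ 1 → ∃ J ∈ X, ¬ C.ev s U J e σ) := by
  induction C with
  | bot => exact ⟨fun _ J _ => by simp [Form.ev], fun _ => hX.imp fun J hJ => by simp [hJ, Form.ev]⟩
  | atom n p ts =>
    simp only [Form.ev, interVal_eq_true] at hF
    push Not at hF
    simpa [Form.numPos, Form.ev] using hF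
  | neg A =>
    cases A with
    | atom n p ts =>
      simp only [Form.ev, interVal_eq_true, not_not] at hF
      have : ∀ J ∈ X, ¬ (Form.neg (.atom n p ts)).ev s U J e σ := fun J hJ => by
        simp [Form.ev, hF J hJ]
      exact ⟨fun _ => this, fun _ => hX.imp fun J hJ => ⟨hJ, this J hJ⟩⟩
    | _ => exact hC.elim
  | or A B ihA ihB =>
    simp only [Form.ev, not_or] at hF ⊢
    obtain ⟨a0, a1⟩ := ihA hC.1 hF.1
    obtain ⟨b0, b1⟩ := ihB hC.2 hF.2
    simp only [Form.numPos]
    refine ⟨fun h J hJ => ⟨a0 (by omega) J hJ, b0 (by omega) J hJ⟩, fun h => ?_⟩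
    by_cases hA : A.numPos = 0
    · obtain ⟨J, hJ, hb⟩ := b1 (by omega)
      exact ⟨J, hJ, a0 hA J hJ, hb⟩
    · obtain ⟨J, hJ, ha⟩ := a1 (by omega)
      exact ⟨J, hJ, ha, b0 (by omega) J hJ⟩
  | top | and | imp | all | ex => exact hC.elim

/-- The models of an expanded Horn formula are closed under intersection. -/
theorem Form.IsHorn.ev_interVal (s : Bool) (U : List ℕ) (X : Set (GAtom → Bool))
    (hX : X.Nonempty) {F : Form} (hF : F.IsHorn) :
    ∀ σ, (∀ J ∈ X, F.ev s U J true σ) → F.ev s U (interVal X) true σ := by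
  induction hF with
  | clause C hC h1 =>
    intro σ h
    by_contra hc
    obtain ⟨J, hJ, hn⟩ := (Form.IsClause.ev_interVal s U X hX true σ C hC hc).2 h1
    exact hn (h J hJ)
  | top => intro σ _; simp [Form.ev]
  | and A B _ _ ihA ihB =>
    intro σ h
    exact ⟨ihA σ fun J hJ => (h J hJ).1, ihB σ fun J hJ => (h J hJ).2⟩
  | all x A _ ih =>
    intro σ h
    simp only [Form.ev] at h ⊢
    exact fun u hu => ih _ fun J hJ => h J hJ u hu
  | ex x A _ ih =>
    intro σ h
    simp only [Form.ev] at h ⊢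
    -- The Skolem instance is the same for all members of `X`; a disjunction of instances would
    -- allow different witnesses.
    exact ih _ h

/-! ### Interpolation at the ground level. -/

/-- A ground Horn clause: the atoms of its negative literals and of its positive literal. -/
abbrev GHorn : Type := List GAtom × Option GAtom

/-- Truth of a ground Horn clause. -/
def GHorn.Sat (J : GAtom → Bool) (C : GHorn) : Prop :=
  (∀ q ∈ C.1, J q = true) → ∃ q ∈ C.2, J q = true

/-- The literals of the ground Horn clause respect the polarities in `V`. -/
def GHorn.Respects (V : Set ((ℕ × ℕ) × Bool)) (C : GHorn) : Prop :=
  (∀ q ∈ C.1, ((q.2.length, q.1), false) ∈ V) ∧ ∀ q ∈ C.2, ((q.2.length, q.1), true) ∈ V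

open Classical in
/-- Interpolation for the expansions of a Horn formula and of a formula. -/
theorem Form.IsHorn.exists_ground_interpolant {F G : Form} (hF : F.IsHorn) {U : List ℕ}
    (h : ∀ J : GAtom → Bool, F.ev true U J true [] → G.ev false U J false []) :
    ∃ I : List GHorn,
      (∀ C ∈ I, C.Respects (F.predsAt true ∩ G.predsAt true)) ∧
      (∀ J, F.ev true U J true [] → ∀ C ∈ I, GHorn.Sat J C) ∧
      (∀ J, (∀ C ∈ I, GHorn.Sat J C) → G.ev false U J false []) := by
  obtain ⟨L₁, hL₁⟩ := F.ev_congr_of_finite true U true []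
  obtain ⟨L₂, hL₂⟩ := G.ev_congr_of_finite false U false []
  set L := L₁ ++ L₂ with hL
  set V := F.predsAt true ∩ G.predsAt true
  let cands : List GHorn :=
    (L.filter fun q => ((q.2.length, q.1), false) ∈ V).sublists ×ˢ
      (none :: (L.filter fun q => ((q.2.length, q.1), true) ∈ V).map some)
  -- The strongest possible choice: every candidate that follows from the expansion of `F`.
  let I : List GHorn := cands.filter fun C => ∀ J, F.ev true U J true [] → GHorn.Sat J C
  refine ⟨I, ?_, ?_, ?_⟩
  · rintro ⟨P, q⟩ hC
    have hc : (P, q) ∈ cands := (List.mem_filter.1 hC).1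
    obtain ⟨hP, hq⟩ := List.mem_product.1 hc
    rw [List.mem_sublists] at hP
    refine ⟨fun r hr => ?_, fun r hr => ?_⟩
    · simpa using (List.mem_filter.1 (hP.subset hr)).2
    · simp only [Option.mem_def] at hr
      subst hr
      simp only [List.mem_cons, reduceCtorEq, List.mem_map, Option.some.injEq,
        exists_eq_right, false_or] at hq
      simpa using (List.mem_filter.1 hq).2
  · intro J hJ C hC
    simpa using of_decide_eq_true (List.mem_filter.1 hC).2 J hJ
  · intro J₀ hJ₀
    -- restrict the valuation to the relevant atoms
    set J : GAtom → Bool := fun q => J₀ q && decide (q ∈ L) with hJdef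
    have hJL : ∀ q, J q = true → q ∈ L := fun q hq => by
      simp only [hJdef, Bool.and_eq_true, decide_eq_true_eq] at hq; exact hq.2
    suffices G.ev false U J false [] by
      refine (hL₂ J J₀ fun q hq => ?_).1 this
      simp [hJdef, hL, hq]
    -- The atoms true in `J` that candidate clauses may use as premises.
    set P : List GAtom := (L.filter fun q => ((q.2.length, q.1), false) ∈ V).filter
      fun q => J q = true with hP
    have hPsub : P ∈ (L.filter fun q => ((q.2.length, q.1), false) ∈ V).sublists :=
      List.mem_sublists.2 List.filter_sublist
    have hPmem : ∀ q, q ∈ P ↔ ((q.2.length, q.1), false) ∈ V ∧ J q = true := fun q => by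
      simp only [hP, List.mem_filter, decide_eq_true_eq]
      exact ⟨fun h => ⟨h.1.2, h.2⟩, fun h => ⟨⟨hJL q h.2, h.1⟩, h.2⟩⟩
    have hPJ₀ : ∀ q ∈ P, J₀ q = true := fun q hq => by
      have := ((hPmem q).1 hq).2
      simp only [hJdef, Bool.and_eq_true] at this
      exact this.1
    set X : Set (GAtom → Bool) := {K | F.ev true U K true [] ∧ ∀ q ∈ P, K q = true} with hXdef
    -- If no model of `F` contained `P`, the clause `P → ⊥` would belong to `I`, but `J₀` satisfies
    -- all its premises.
    have hX : X.Nonempty := by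
      by_contra hne
      rw [Set.not_nonempty_iff_eq_empty] at hne
      have hmem : ((P, none) : GHorn) ∈ I := by
        refine List.mem_filter.2 ⟨List.mem_product.2 ⟨hPsub, by simp⟩, decide_eq_true ?_⟩
        intro K hK hKP
        have : K ∈ X := ⟨hK, hKP⟩
        rw [hne] at this
        exact this.elim
      obtain ⟨q, hq, _⟩ := hJ₀ _ hmem hPJ₀
      simp at hq
    set M := interVal X with hM
    have hMF : F.ev true U M true [] := hF.ev_interVal true U X hX [] fun K hK => hK.1
    have hMP : ∀ q ∈ P, M q = true := fun q hq => interVal_eq_true.2 fun K hK => hK.2 q hq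
    -- atoms of the least model that are not in `P` occur positively
    have hMpos : ∀ q, M q = true → q ∈ P ∨ ((q.2.length, q.1), true) ∈ F.predsAt true := by
      intro q hq
      by_contra! hc
      -- Deleting an atom that does not occur positively in `F` keeps `F` true, so the minimality of
      -- `M` is violated.
      have : (fun r => M r && decide (r ≠ q)) ∈ X := by
        refine ⟨(F.ev_mono true U true true [] M _ ?_ ?_).1 rfl hMF, ?_⟩
        · intro r hr hMr
          have : r ≠ q := fun h => hc.2 (h ▸ hr)
          simp [hMr, this]
        · intro r _ hr
          simp only [Bool.and_eq_true] at hr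
          exact hr.1
        · intro r hr
          have : r ≠ q := fun h => hc.1 (h ▸ hr)
          simp [hMP r hr, this]
      have := interVal_eq_true.1 hq _ this
      simp at this
    -- Cutting `M` down to `L` stays within `X`: `L` contains all atoms that decide `F`, and it
    -- contains `P`.
    have hMinL : ∀ q, M q = true → q ∈ L := by
      intro q hq
      by_contra hc
      have : (fun r => M r && decide (r ∈ L)) ∈ X := by
        refine ⟨(hL₁ M _ fun r hr => ?_).1 hMF, fun r hr => ?_⟩
        · simp [hL, hr]
        · simp [hMP r hr, hJL r ((hPmem r).1 hr).2]
      have := interVal_eq_true.1 hq _ this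
      simp [hc] at this
    -- The added atoms do not occur negatively in `F`, so `F` stays true. Compared with `J`, the
    -- valuation `K` has no further atoms that are positive in `G` and lacks none that are negative
    -- in `G`; hence the truth of `G` passes from `K` to `J`.
    set K : GAtom → Bool :=
      fun q => M q || (J q && decide (((q.2.length, q.1), false) ∉ F.predsAt true)) with hK
    have hKF : F.ev true U K true [] := by
      refine (F.ev_mono true U true true [] M K ?_ ?_).1 rfl hMF
      · intro q _ hq; simp [hK, hq]
      · intro q hq hKq
        simpa [hK, hq] using hKq
    refine (G.ev_mono false U true false [] K J ?_ ?_).1 rfl (h K hKF)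
    · intro q hq hKq
      by_cases hJq : J q = true
      · exact hJq
      have hMq : M q = true := by simpa [hK, hJq] using hKq
      rcases hMpos q hMq with hqP | hqF
      · exact ((hPmem q).1 hqP).2
      -- As `q` is in the least model over `P`, the clause `P → q` follows from `F`.
      have hmem : ((P, some q) : GHorn) ∈ I := by
        refine List.mem_filter.2 ⟨List.mem_product.2 ⟨hPsub, ?_⟩, decide_eq_true ?_⟩
        · simp only [List.mem_cons, reduceCtorEq, List.mem_map, Option.some.injEq,
            exists_eq_right, false_or]
          exact List.mem_filter.2 ⟨hMinL q hMq, decide_eq_true ⟨hqF, hq⟩⟩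
        · intro K' hK' hKP'
          exact ⟨q, rfl, interVal_eq_true.1 hMq K' ⟨hK', hKP'⟩⟩
      obtain ⟨r, hr, hJr⟩ := hJ₀ _ hmem hPJ₀
      simp only [Option.mem_def, Option.some.injEq] at hr
      subst hr
      simp [hJdef, hJr, hMinL q hMq]
    · intro q hq hJq
      by_cases hqF : ((q.2.length, q.1), false) ∈ F.predsAt true
      · have : q ∈ P := (hPmem q).2 ⟨⟨hqF, hq⟩, hJq⟩
        simp [hK, hMP q this]
      · simp [hK, hJq, hqF]

/-! ## Injectivity of the Gödel numbering -/

theorem termCode_injective : Function.Injective termCode := by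
  intro t
  induction t with
  | var x => intro t' h; cases t' <;> simp_all [termCode, Nat.pair_eq_pair]
  | @func n f ts ih =>
    intro t' h
    cases t' with
    | var => simp [termCode, Nat.pair_eq_pair] at h
    | @func m g us =>
      simp only [termCode, Nat.pair_eq_pair, true_and] at h
      obtain ⟨rfl, h⟩ := h
      have h := Encodable.encode_injective h
      have hn : n = m := by simpa using congrArg List.length h
      subst hn
      have := List.ofFn_injective h
      congr 1
      funext i
      exact ih i (congrFun this i)

/-- The arity is not stored but is the length of the encoded list, hence the equality in a sigma
type. -/
theorem argsCode_inj {n m : ℕ} {ts : Fin n → Trm} {us : Fin m → Trm}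
    (h : argsCode ts = argsCode us) : (⟨n, ts⟩ : Σ k, Fin k → Trm) = ⟨m, us⟩ := by
  have h := Encodable.encode_injective h
  have hn : n = m := by simpa using congrArg List.length h
  subst hn
  have := List.ofFn_injective h
  congr 1
  funext i
  exact termCode_injective (congrFun this i)

/-- A Skolem term stores its matrix only as a code; injectivity lets `val` recover the formula. -/
theorem Form.code_injective : Function.Injective Form.code := by
  intro A
  induction A with
  | atom n p ts =>
    intro B h
    cases B <;> simp [Form.code, Nat.pair_eq_pair] at h
    obtain ⟨rfl, h⟩ := h
    cases argsCode_inj h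
    rfl
  | top | bot => intro B h; cases B <;> simp [Form.code, Nat.pair_eq_pair] at h ⊢
  | neg A ih =>
    intro B h
    cases B <;> simp [Form.code, Nat.pair_eq_pair] at h ⊢
    exact ih h
  | and A B ihA ihB | or A B ihA ihB | imp A B ihA ihB =>
    intro C h
    cases C <;> simp [Form.code, Nat.pair_eq_pair] at h ⊢
    exact ⟨ihA h.1, ihB h.2⟩
  | all x A ih | ex x A ih =>
    intro B h
    cases B <;> simp [Form.code, Nat.pair_eq_pair] at h ⊢
    exact ⟨h.1, ih h.2⟩

/-- The formula with a given code. -/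
noncomputable def Form.ofCode (c : ℕ) : Form :=
  letI : Nonempty Form := ⟨.top⟩
  Function.invFun Form.code c

theorem Form.ofCode_code (A : Form) : Form.ofCode A.code = A :=
  letI : Nonempty Form := ⟨.top⟩
  Function.leftInverse_invFun Form.code_injective A

/-! ## Components of ground terms -/

theorem lt_encode_of_mem {l : List ℕ} {x : ℕ} (h : x ∈ l) : x < Encodable.encode l := by
  induction l with
  | nil => simp at h
  | cons y l ih =>
    rw [Encodable.encode_list_cons]
    rcases List.mem_cons.1 h with rfl | h
    · exact Nat.lt_succ_of_le (Nat.left_le_pair _ _)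
    · exact (ih h).trans_le ((Nat.right_le_pair _ _).trans (Nat.le_succ _))

theorem lt_encode_of_mem_env {σ : List (ℕ × ℕ)} {y u : ℕ} (h : (y, u) ∈ σ) :
    u < Encodable.encode σ := by
  induction σ with
  | nil => simp at h
  | cons z σ ih =>
    rw [Encodable.encode_list_cons]
    rcases List.mem_cons.1 h with rfl | h
    · exact Nat.lt_succ_of_le ((Nat.right_le_pair y u).trans (Nat.left_le_pair _ _))
    · exact (ih h).trans_le ((Nat.right_le_pair _ _).trans (Nat.le_succ _))

/-- The arguments of a ground term that starts with a function. -/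
def argsOf (n : ℕ) : List ℕ := Denumerable.ofNat (List ℕ) n.unpair.2.unpair.2

theorem argsOf_fnT (f : ℕ) (ts : List ℕ) : argsOf (fnT f ts) = ts := by
  simp [argsOf, fnT]

/-- Arguments have smaller codes than the term, so recursion on ground terms is strong recursion on
numbers. -/
theorem lt_of_mem_argsOf {n x : ℕ} (h : x ∈ argsOf n) : x < n := by
  have := lt_encode_of_mem h
  rw [argsOf, Denumerable.encode_ofNat] at this
  exact this.trans_le ((Nat.unpair_right_le _).trans (Nat.unpair_right_le _))

/-- The environment of a Skolem term. -/
def envOf (n : ℕ) : List (ℕ × ℕ) :=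
  Denumerable.ofNat (List (ℕ × ℕ)) n.unpair.2.unpair.2.unpair.2.unpair.2.unpair.2

theorem envOf_epsT (s e : Bool) (x c : ℕ) (σ : List (ℕ × ℕ)) : envOf (epsT s e x c σ) = σ := by
  simp [envOf, epsT]

theorem lt_of_lookup_envOf {n y u : ℕ} (h : (envOf n).lookup y = some u) : u < n := by
  have hm : (y, u) ∈ envOf n := by
    obtain ⟨l₁, l₂, hl, _⟩ := List.lookup_eq_some_iff.1 h
    simp [hl]
  have := lt_encode_of_mem_env hm
  rw [envOf, Denumerable.encode_ofNat] at this
  exact this.trans_le ((Nat.unpair_right_le _).trans <| (Nat.unpair_right_le _).trans <|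
    (Nat.unpair_right_le _).trans <| (Nat.unpair_right_le _).trans (Nat.unpair_right_le _))

/-! ## Values of ground terms in a structure -/

/-- The ground term starts with a variable, with a function from `K` or with a Skolem function of
a side in `T`. -/
def Interpreted (K : Set (ℕ × ℕ)) (T : Set Bool) (n : ℕ) : Prop :=
  n.unpair.1 = 0 ∨ (n.unpair.1 = 1 ∧ ((argsOf n).length, n.unpair.2.unpair.1) ∈ K) ∨
    (n.unpair.1 = 2 ∧ ∃ s ∈ T, n.unpair.2.unpair.1 = s.toNat)

/-- The assignment given by an environment and values `g` of the ground terms. -/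
def envVal {M : Type} (v : ℕ → M) (g : ℕ → M) (σ : List (ℕ × ℕ)) (y : ℕ) : M :=
  ((σ.lookup y).map g).getD (v y)

open Classical in
/-- The value of a ground term in the structure `S` in dependence on the values `g` of smaller
ground terms. -/
noncomputable def valStep {M : Type} [Nonempty M] (S : Sig.Structure M) (v : ℕ → M)
    (K : Set (ℕ × ℕ)) (T : Set Bool) (a g : ℕ → M) (n : ℕ) : M :=
  if Interpreted K T n then
    if n.unpair.1 = 0 then v n.unpair.2
    else if n.unpair.1 = 1 then
      @Structure.funMap Sig M S (argsOf n).length n.unpair.2.unpair.1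
        fun i => g ((argsOf n).get i)
    else
      Classical.epsilon fun b : M =>
        ((Form.ofCode n.unpair.2.unpair.2.unpair.2.unpair.2.unpair.1).Sat S
          (Function.update (envVal v g (envOf n)) n.unpair.2.unpair.2.unpair.2.unpair.1 b) ↔
            n.unpair.2.unpair.2.unpair.1 = 1)
  else a n

/-- The value of a ground term in the structure `S` under the assignment `v`. The functions in `K`
are interpreted as in `S`, the Skolem functions of the sides in `T` yield witnesses, and all other terms
have arbitrary values given by `a`. -/
noncomputable def val {M : Type} [Nonempty M] (S : Sig.Structure M) (v : ℕ → M)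
    (K : Set (ℕ × ℕ)) (T : Set Bool) (a : ℕ → M) (n : ℕ) : M :=
  valStep S v K T a (fun m => if _h : m < n then val S v K T a m else v 0) n
termination_by n

section Values

variable {M : Type} [Nonempty M] (S : Sig.Structure M) (v : ℕ → M)
    (K : Set (ℕ × ℕ)) (T : Set Bool) (a : ℕ → M)

/-- The arguments and environment entries that are consulted lie below `n`. The default value in
`val` is therefore never read, which gives the unguarded recursion equation `val_eq`. -/
theorem valStep_congr {a a' g g' : ℕ → M} {n : ℕ} (ha : a n = a' n) (h : ∀ m < n, g m = g' m) :
    valStep S v K T a g n = valStep S v K T a' g' n := by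
  have henv : envVal v g (envOf n) = envVal v g' (envOf n) := by
    funext y
    rw [envVal, envVal]
    cases hu : (envOf n).lookup y with
    | none => rfl
    | some u => exact h u (lt_of_lookup_envOf hu)
  have hargs : (fun i => g ((argsOf n).get i)) = fun i => g' ((argsOf n).get i) :=
    funext fun i => h _ (lt_of_mem_argsOf (List.get_mem (argsOf n) i))
  rw [valStep, valStep, henv, hargs, ha]

theorem val_eq (n : ℕ) : val S v K T a n = valStep S v K T a (val S v K T a) n := by
  rw [val]
  exact valStep_congr S v K T rfl fun m hm => by simp [hm]

theorem val_of_not_interpreted {n : ℕ} (h : ¬ Interpreted K T n) : val S v K T a n = a n := by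
  rw [val_eq, valStep, if_neg h]

theorem val_parT (x : ℕ) : val S v K T a (parT x) = v x := by
  have h : Interpreted K T (parT x) := by simp [Interpreted, parT]
  rw [val_eq, valStep, if_pos h, if_pos (by simp [parT])]
  simp [parT]

theorem val_fnT {n : ℕ} (f : ℕ) (ts : Fin n → ℕ) (h : (n, f) ∈ K) :
    val S v K T a (fnT f (List.ofFn ts)) =
      @Structure.funMap Sig M S n f fun i => val S v K T a (ts i) := by
  have hi : Interpreted K T (fnT f (List.ofFn ts)) := by
    refine .inr (.inl ⟨by simp [fnT], ?_⟩)
    rw [argsOf_fnT]; simpa [fnT] using h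
  rw [val_eq, valStep, if_pos hi, if_neg (by simp [fnT]), if_pos (by simp [fnT])]
  -- The decoded list equals `List.ofFn ts` only propositionally, and its length is an arity;
  -- generalizing the list avoids transports.
  have key : ∀ (l : List ℕ) (g : ℕ), l = List.ofFn ts → g = f →
      @Structure.funMap Sig M S l.length g (fun i => val S v K T a (l.get i)) =
      @Structure.funMap Sig M S n f fun i => val S v K T a (ts i) := by
    rintro l g hl rfl
    have hn : l.length = n := by simp [hl]
    subst hn
    congr 1
    funext i
    have : l.get i = (List.ofFn ts).get (i.cast (by simp)) := by
      congr 1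
      · rw [Fin.heq_ext_iff (by simp)]; rfl
    rw [this]; simp
  exact key _ _ (argsOf_fnT _ _) (by simp [fnT])

/-- The term denotes a witness of `A` if `e` is true and a counterexample if `e` is false, whenever
one exists. -/
theorem val_epsT {s : Bool} (hs : s ∈ T) (e : Bool) (x : ℕ) (A : Form) (σ : List (ℕ × ℕ)) :
    val S v K T a (epsT s e x A.code σ) = Classical.epsilon fun b : M =>
      (A.Sat S (Function.update (fun y => val S v K T a (look σ y)) x b) ↔ e = true) := by
  have hi : Interpreted K T (epsT s e x A.code σ) := .inr (.inr ⟨by simp [epsT], s, hs, by simp [epsT]⟩)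
  have henv : envVal v (val S v K T a) (envOf (epsT s e x A.code σ)) =
      fun y => val S v K T a (look σ y) := by
    funext y
    rw [envOf_epsT, envVal, look]
    cases σ.lookup y with
    | none => simp [val_parT]
    | some u => rfl
  rw [val_eq, valStep, if_pos hi, if_neg (by simp [epsT]), if_neg (by simp [epsT]), henv]
  have he : e.toNat = 1 ↔ e = true := by cases e <;> simp
  simp [epsT, Form.ofCode_code, he]

/-- The filler values above `n` have no influence. Hence values for uninterpreted terms may be
chosen one after the other in increasing order. -/
theorem val_congr {a a' : ℕ → M} (n : ℕ) (h : ∀ m ≤ n, a m = a' m) :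
    val S v K T a n = val S v K T a' n := by
  induction n using Nat.strong_induction_on with
  | _ n ih =>
    rw [val_eq, val_eq]
    exact valStep_congr S v K T (h n le_rfl) fun m hm => ih m hm fun k hk => h k (hk.trans hm.le)

theorem val_inst (σ : List (ℕ × ℕ)) (t : Trm) (ht : termFuns t ⊆ K) :
    val S v K T a (inst σ t) = termVal S (fun x => val S v K T a (look σ x)) t := by
  induction t with
  | var x => rfl
  | @func n f ts ih =>
    simp only [termFuns, Set.insert_subset_iff, Set.iUnion_subset_iff] at ht
    rw [inst, val_fnT S v K T a f _ ht.1]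
    simp only [fun i => ih i (ht.2 i)]
    rfl

open Classical in
/-- The valuation of the ground atoms that is induced by a structure. -/
noncomputable def inducedVal : GAtom → Bool := fun q =>
  decide (@Structure.RelMap Sig M S q.2.length q.1 fun i => val S v K T a (q.2.get i))

theorem inducedVal_instAtom (σ : List (ℕ × ℕ)) {n : ℕ} (p : ℕ) (ts : Fin n → Trm)
    (ht : ∀ i, termFuns (ts i) ⊆ K) :
    inducedVal S v K T a (instAtom σ p ts) = true ↔
      AtomSat S (fun x => val S v K T a (look σ x)) n p ts := by
  refine (@decide_eq_true_iff _ (Classical.propDecidable _)).trans ?_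
  have key : ∀ l : List ℕ, l = (List.ofFn fun i => inst σ (ts i)) →
      ((@Structure.RelMap Sig M S l.length p fun i => val S v K T a (l.get i)) ↔
        @Structure.RelMap Sig M S n p fun i => val S v K T a (inst σ (ts i))) := by
    intro l hl
    have hn : l.length = n := by simp [hl]
    subst hn
    refine iff_of_eq (congrArg _ ?_)
    funext i
    have : l.get i = (List.ofFn fun i => inst σ (ts i)).get (i.cast (by simp)) := by
      congr 1
      · rw [Fin.heq_ext_iff (by simp)]; rfl
    rw [this]; simp
  refine (key _ rfl).trans ?_
  simp only [fun i => val_inst S v K T a σ (ts i) (ht i)]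
  rfl

/-- The valuation induced by a structure satisfies the expansion of a true formula, and falsifies
the expansion of a false one. -/
theorem Form.ev_inducedVal {s : Bool} (hs : s ∈ T) (U : List ℕ) (A : Form) (hA : A.funs ⊆ K) :
    ∀ σ, (A.Sat S (fun x => val S v K T a (look σ x)) →
        A.ev s U (inducedVal S v K T a) true σ) ∧
      (A.ev s U (inducedVal S v K T a) false σ →
        A.Sat S fun x => val S v K T a (look σ x)) := by
  have upd : ∀ (σ : List (ℕ × ℕ)) (x u : ℕ), (fun y => val S v K T a (look ((x, u) :: σ) y)) =
      Function.update (fun y => val S v K T a (look σ y)) x (val S v K T a u) := by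
    intro σ x u
    funext y
    rw [look_cons]
    by_cases h : y = x
    · subst h; simp
    · simp [Function.update_of_ne h]
  induction A with
  | top => intro σ; simp [Form.ev, Form.Sat]
  | bot => intro σ; simp [Form.ev, Form.Sat]
  | atom n p ts =>
    intro σ
    have := inducedVal_instAtom S v K T a σ p ts (Set.iUnion_subset_iff.1 hA)
    simp [Form.ev, Form.Sat, this]
  | neg A ih =>
    intro σ
    have := ih hA σ
    simp only [Form.ev, Form.Sat, Bool.not_true, Bool.not_false]; tauto
  | and A B ihA ihB | or A B ihA ihB =>
    intro σ
    obtain ⟨h1, h2⟩ := Set.union_subset_iff.1 hA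
    have := ihA h1 σ; have := ihB h2 σ
    simp only [Form.ev, Form.Sat]; tauto
  | imp A B ihA ihB =>
    intro σ
    obtain ⟨h1, h2⟩ := Set.union_subset_iff.1 hA
    have := ihA h1 σ; have := ihB h2 σ
    simp only [Form.ev, Form.Sat, Bool.not_true, Bool.not_false]; tauto
  | all x A ih =>
    intro σ
    simp only [Form.ev, Form.Sat]
    refine ⟨fun H u _ => (ih hA _).1 ?_, fun H => ?_⟩
    · rw [upd]; exact H _
    · have h := (ih hA _).2 H
      rw [upd, val_epsT S v K T a hs] at h
      -- If the universal formula failed, the Skolem term would denote a counterexample to `A`,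
      -- against `h`.
      by_contra! hc
      exact (Classical.epsilon_spec (p := fun b : M =>
        (A.Sat S (Function.update (fun y => val S v K T a (look σ y)) x b) ↔ false = true))
        (hc.imp fun b hb => by simpa using hb)).1 h |> Bool.false_ne_true
  | ex x A ih =>
    intro σ
    simp only [Form.ev, Form.Sat]
    refine ⟨fun H => (ih hA _).1 ?_, fun ⟨u, _, H⟩ => ⟨val S v K T a u, ?_⟩⟩
    · rw [upd, val_epsT S v K T a hs]
      exact (Classical.epsilon_spec (p := fun b : M =>
        (A.Sat S (Function.update (fun y => val S v K T a (look σ y)) x b) ↔ true = true))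
        (H.imp fun b hb => by simpa using hb)).2 rfl
    · rw [← upd]; exact (ih hA _).2 H

end Values

/-- Herbrand's theorem: the characterization of entailment by finite expansions. -/
theorem entails_iff_exists_expansion {F G : Form} :
    Entails F G ↔ ∃ U : List ℕ, ∀ J : GAtom → Bool,
      F.ev true U J true [] → G.ev false U J false [] := by
  refine ⟨Entails.exists_expansion, fun ⟨U, hU⟩ M _ S v hF => ?_⟩
  -- All functions and the Skolem functions of both sides are interpreted together, so one valuation
  -- serves `F` and `G`. The last `v` merely fills in numbers that are no such terms.
  have hv : (fun x => val S v Set.univ Set.univ v (look [] x)) = v := by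
    funext x; rw [look_nil, val_parT]
  have h := hU (inducedVal S v Set.univ Set.univ v)
    ((F.ev_inducedVal S v _ _ v (Set.mem_univ true) U (Set.subset_univ _) []).1 (by rwa [hv]))
  have := (G.ev_inducedVal S v _ _ v (Set.mem_univ false) U (Set.subset_univ _) []).2 h
  rwa [hv] at this

/-! ## Lifting of ground interpolants -/

/-- The ground term is a variable or starts with a function from `K`. -/
def Kept (K : Set (ℕ × ℕ)) (n : ℕ) : Prop :=
  n.unpair.1 = 0 ∨ (n.unpair.1 = 1 ∧ ((argsOf n).length, n.unpair.2.unpair.1) ∈ K)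

theorem Kept.interpreted {K K' : Set (ℕ × ℕ)} (T : Set Bool) (hK : K ⊆ K') {n : ℕ}
    (h : Kept K n) : Interpreted K' T n :=
  h.imp id fun h => .inl ⟨h.1, hK h.2⟩

open Classical in
/-- Replace the maximal subterms that do not start with a function from `K` by variables. -/
noncomputable def abstr (K : Set (ℕ × ℕ)) (N n : ℕ) : Trm :=
  if Kept K n then
    if n.unpair.1 = 0 then .var n.unpair.2
    else .func (L := Sig) (l := (argsOf n).length) n.unpair.2.unpair.1
      fun i => abstr K N ((argsOf n).get i)
  else .var (N + n)
termination_by n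
decreasing_by exact lt_of_mem_argsOf (List.getElem_mem _)

theorem termFuns_abstr (K : Set (ℕ × ℕ)) (N n : ℕ) : termFuns (abstr K N n) ⊆ K := by
  induction n using Nat.strong_induction_on with
  | _ n ih =>
    rw [abstr]
    split_ifs with h h0
    · simp [termFuns]
    · refine Set.insert_subset (h.resolve_left h0).2 (Set.iUnion_subset fun i => ?_)
      exact ih _ (lt_of_mem_argsOf (List.getElem_mem _))
    · simp [termFuns]

/-- A variable occurring in a ground term is at most the code of the term, hence below `N` and
distinct from the new variables `N + m`. -/
theorem varFinset_abstr (K : Set (ℕ × ℕ)) (N n : ℕ) (hn : n < N) :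
    ((abstr K N n).varFinset : Set ℕ) ⊆ {x | x < N ∨ ∃ m < N, ¬ Kept K m ∧ x = N + m} := by
  induction n using Nat.strong_induction_on with
  | _ n ih =>
    rw [abstr]
    split_ifs with h h0
    · intro x hx
      simp only [Term.varFinset, Finset.coe_singleton, Set.mem_singleton_iff] at hx
      subst hx
      exact .inl ((Nat.unpair_right_le n).trans_lt hn)
    · intro x hx
      simp only [Term.varFinset, Finset.coe_biUnion, Set.mem_iUnion] at hx
      obtain ⟨i, _, hx⟩ := hx
      have := lt_of_mem_argsOf (List.getElem_mem (l := argsOf n) i.2)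
      exact ih _ this (this.trans hn) hx
    · intro x hx
      simp only [Term.varFinset, Finset.coe_singleton, Set.mem_singleton_iff] at hx
      exact .inr ⟨n, hn, h, hx⟩

/-- Retained heads lie in `K'`, so `val` evaluates them as `S` does; at the cut-off subterms the two
sides agree by `hw`. -/
theorem termVal_abstr {M : Type} [Nonempty M] (S : Sig.Structure M) (v : ℕ → M)
    {K K' : Set (ℕ × ℕ)} (hK : K ⊆ K') (T : Set Bool) (a w : ℕ → M) {N : ℕ}
    (hv : ∀ x < N, w x = v x)
    (hw : ∀ m < N, ¬ Kept K m → w (N + m) = val S v K' T a m) (n : ℕ) (hn : n < N) :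
    termVal S w (abstr K N n) = val S v K' T a n := by
  induction n using Nat.strong_induction_on with
  | _ n ih =>
    rw [abstr]
    split_ifs with h h0
    · rw [val_eq, valStep, if_pos (h.interpreted T hK), if_pos h0]
      exact hv _ ((Nat.unpair_right_le n).trans_lt hn)
    · rw [val_eq, valStep, if_pos (h.interpreted T hK), if_neg h0, if_pos (h.resolve_left h0).1]
      change @Structure.funMap Sig M S _ _ (fun i => termVal S w (abstr K N ((argsOf n).get i))) = _
      congr 1
      funext i
      have := lt_of_mem_argsOf (List.get_mem (argsOf n) i)
      exact ih _ this (this.trans hn)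
    · exact hw n hn h

/-- The formula for a ground atom. -/
noncomputable def atomForm (K : Set (ℕ × ℕ)) (N : ℕ) (q : GAtom) : Form :=
  .atom q.2.length q.1 fun i => abstr K N (q.2.get i)

/-- The formula for a ground Horn clause. -/
noncomputable def GHorn.form (K : Set (ℕ × ℕ)) (N : ℕ) (C : GHorn) : Form :=
  C.1.foldr (fun q A => .or (.neg (atomForm K N q)) A) ((C.2.map (atomForm K N)).getD .bot)

/-- The conjunction of the formulas for ground Horn clauses. -/
noncomputable def matrixForm (K : Set (ℕ × ℕ)) (N : ℕ) (I : List GHorn) : Form :=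
  I.foldr (fun C A => .and (C.form K N) A) .top

theorem GHorn.isClause_form (K : Set (ℕ × ℕ)) (N : ℕ) (C : GHorn) :
    (C.form K N).IsClause ∧ (C.form K N).numPos ≤ 1 := by
  obtain ⟨P, q⟩ := C
  induction P with
  | nil => cases q <;> simp [GHorn.form, atomForm, Form.IsClause, Form.numPos]
  | cons p P ih => simpa [GHorn.form, atomForm, Form.IsClause, Form.numPos] using ih

theorem isHorn_matrixForm (K : Set (ℕ × ℕ)) (N : ℕ) (I : List GHorn) :
    (matrixForm K N I).IsHorn := by
  induction I with
  | nil => exact .top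
  | cons C I ih => exact .and _ _ (.clause _ (C.isClause_form K N).1 (C.isClause_form K N).2) ih

theorem predsAt_matrixForm (K : Set (ℕ × ℕ)) (N : ℕ) (I : List GHorn)
    (V : Set ((ℕ × ℕ) × Bool)) (h : ∀ C ∈ I, C.Respects V) :
    (matrixForm K N I).predsAt true ⊆ V := by
  have hC : ∀ C : GHorn, C.Respects V → (C.form K N).predsAt true ⊆ V := by
    rintro ⟨P, q⟩ ⟨h1, h2⟩
    induction P with
    | nil =>
      cases q with
      | none => simp [GHorn.form, Form.predsAt]
      | some q => simpa [GHorn.form, Form.predsAt, atomForm] using h2 q rfl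
    | cons p P ih =>
      refine Set.union_subset ?_ (ih (fun q hq => h1 q (by simp [hq])) h2)
      simpa [atomForm, Form.predsAt] using h1 p (by simp)
  induction I with
  | nil => simp [matrixForm, Form.predsAt]
  | cons C I ih =>
    exact Set.union_subset (hC C (h C (by simp))) (ih fun D hD => h D (by simp [hD]))

theorem funs_matrixForm (K : Set (ℕ × ℕ)) (N : ℕ) (I : List GHorn) :
    (matrixForm K N I).funs ⊆ K := by
  have hA : ∀ q, (atomForm K N q).funs ⊆ K := fun q =>
    Set.iUnion_subset fun i => termFuns_abstr K N _
  have hC : ∀ C : GHorn, (C.form K N).funs ⊆ K := by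
    rintro ⟨P, q⟩
    induction P with
    | nil =>
      cases q with
      | none => simp [GHorn.form, Form.funs]
      | some q => exact hA q
    | cons p P ih => exact Set.union_subset (hA p) ih
  induction I with
  | nil => simp [matrixForm, Form.funs]
  | cons C I ih => exact Set.union_subset (hC C) ih

/-- All arguments of the atoms of the clause are less than `N`. -/
def GHorn.Below (N : ℕ) (C : GHorn) : Prop :=
  (∀ q ∈ C.1, ∀ t ∈ q.2, t < N) ∧ ∀ q ∈ C.2, ∀ t ∈ q.2, t < N

/-- The bound serves twice: it limits the terms that need a quantifier, and it separates the
original variables from those standing for terms. -/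
theorem exists_below (I : List GHorn) : ∃ N, ∀ C ∈ I, C.Below N := by
  let L : List ℕ := I.flatMap fun C => C.1.flatMap Prod.snd ++ C.2.toList.flatMap Prod.snd
  refine ⟨L.sum + 1, fun C hC => ⟨fun q hq t ht => ?_, fun q hq t ht => ?_⟩⟩
  · refine Nat.lt_succ_of_le (List.single_le_sum (by simp) t ?_)
    exact List.mem_flatMap.2 ⟨C, hC, List.mem_append_left _ (List.mem_flatMap.2 ⟨q, hq, ht⟩)⟩
  · refine Nat.lt_succ_of_le (List.single_le_sum (by simp) t ?_)
    exact List.mem_flatMap.2 ⟨C, hC, List.mem_append_right _ (List.mem_flatMap.2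
      ⟨q, by simpa using hq, ht⟩)⟩

theorem freeVars_matrixForm (K : Set (ℕ × ℕ)) (N : ℕ) (I : List GHorn)
    (h : ∀ C ∈ I, C.Below N) :
    (matrixForm K N I).freeVars ⊆ {x | x < N ∨ ∃ m < N, ¬ Kept K m ∧ x = N + m} := by
  have hA : ∀ q : GAtom, (∀ t ∈ q.2, t < N) →
      (atomForm K N q).freeVars ⊆ {x | x < N ∨ ∃ m < N, ¬ Kept K m ∧ x = N + m} := fun q hq =>
    Set.iUnion_subset fun i => varFinset_abstr K N _ (hq _ (List.get_mem _ _))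
  have hC : ∀ C : GHorn, C.Below N →
      (C.form K N).freeVars ⊆ {x | x < N ∨ ∃ m < N, ¬ Kept K m ∧ x = N + m} := by
    rintro ⟨P, q⟩ ⟨h1, h2⟩
    induction P with
    | nil =>
      cases q with
      | none => simp [GHorn.form, Form.freeVars]
      | some q => exact hA q (h2 q rfl)
    | cons p P ih =>
      exact Set.union_subset (hA p (h1 p (by simp))) (ih (fun q hq => h1 q (by simp [hq])) h2)
  induction I with
  | nil => simp [matrixForm, Form.freeVars]
  | cons C I ih =>
    exact Set.union_subset (hC C (h C (by simp))) (ih fun D hD => h D (by simp [hD]))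

theorem sat_matrixForm {M : Type} [Nonempty M] (S : Sig.Structure M) (v : ℕ → M)
    {K K' : Set (ℕ × ℕ)} (hK : K ⊆ K') (T : Set Bool) (a w : ℕ → M) {N : ℕ}
    (hv : ∀ x < N, w x = v x)
    (hw : ∀ m < N, ¬ Kept K m → w (N + m) = val S v K' T a m) (I : List GHorn)
    (h : ∀ C ∈ I, C.Below N) :
    (matrixForm K N I).Sat S w ↔ ∀ C ∈ I, GHorn.Sat (inducedVal S v K' T a) C := by
  have hA : ∀ q : GAtom, (∀ t ∈ q.2, t < N) →
      ((atomForm K N q).Sat S w ↔ inducedVal S v K' T a q = true) := by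
    intro q hq
    refine Iff.trans ?_ (@decide_eq_true_iff _ (Classical.propDecidable _)).symm
    have : (fun i => termVal S w (abstr K N (q.2.get i))) =
        fun i => val S v K' T a (q.2.get i) := funext fun i =>
      termVal_abstr S v hK T a w hv hw _ (hq _ (List.get_mem _ _))
    rw [← this]
    rfl
  have hC : ∀ C : GHorn, C.Below N →
      ((C.form K N).Sat S w ↔ GHorn.Sat (inducedVal S v K' T a) C) := by
    rintro ⟨P, q⟩ ⟨h1, h2⟩
    induction P with
    | nil =>
      cases q with
      | none => simp [GHorn.form, Form.Sat, GHorn.Sat]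
      | some q => simpa [GHorn.form, GHorn.Sat] using hA q (h2 q rfl)
    | cons p P ih =>
      have i := ih (fun q hq => h1 q (by simp [hq])) h2
      have e : (GHorn.form K N (p :: P, q)).Sat S w ↔
          ¬ (atomForm K N p).Sat S w ∨ (GHorn.form K N (P, q)).Sat S w := Iff.rfl
      rw [e, i, hA p (h1 p (by simp))]
      simp only [GHorn.Sat, List.mem_cons, forall_eq_or_imp]
      tauto
  induction I with
  | nil => simp [matrixForm, Form.Sat]
  | cons C I ih =>
    have e : (matrixForm K N (C :: I)).Sat S w ↔
        (C.form K N).Sat S w ∧ (matrixForm K N I).Sat S w := Iff.rfl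
    have i : (matrixForm K N I).Sat S w ↔ _ := ih fun D hD => h D (List.mem_cons_of_mem _ hD)
    rw [e, hC C (h C (by simp)), i]
    simp

/-! ### The quantifier prefix and its game semantics. -/

open Classical in
/-- Quantify the variables `N + j, ..., N + j + k - 1` that stand for ground terms: existentially
those for terms in `E`, universally the others. -/
noncomputable def quantify (K : Set (ℕ × ℕ)) (E : ℕ → Prop) (N : ℕ) (A : Form) : ℕ → ℕ → Form
  | _, 0 => A
  | j, k + 1 =>
    if Kept K j then quantify K E N A (j + 1) k
    else if E j then .ex (N + j) (quantify K E N A (j + 1) k)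
    else .all (N + j) (quantify K E N A (j + 1) k)

theorem isHorn_quantify (K : Set (ℕ × ℕ)) (E : ℕ → Prop) (N : ℕ) {A : Form} (hA : A.IsHorn)
    (j k : ℕ) : (quantify K E N A j k).IsHorn := by
  induction k generalizing j with
  | zero => exact hA
  | succ k ih =>
    rw [quantify]
    split_ifs
    · exact ih _
    · exact .ex _ _ (ih _)
    · exact .all _ _ (ih _)

theorem predsAt_quantify (K : Set (ℕ × ℕ)) (E : ℕ → Prop) (N : ℕ) (A : Form) (pol : Bool)
    (j k : ℕ) : (quantify K E N A j k).predsAt pol = A.predsAt pol := by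
  induction k generalizing j with
  | zero => rfl
  | succ k ih => rw [quantify]; split_ifs <;> exact ih _

theorem funs_quantify (K : Set (ℕ × ℕ)) (E : ℕ → Prop) (N : ℕ) (A : Form) (j k : ℕ) :
    (quantify K E N A j k).funs = A.funs := by
  induction k generalizing j with
  | zero => rfl
  | succ k ih => rw [quantify]; split_ifs <;> exact ih _

/-- The quantifier at position `j` binds the variable of term `j`; if `j` is kept, that variable
does not occur in the first place. -/
theorem freeVars_quantify (K : Set (ℕ × ℕ)) (E : ℕ → Prop) (N : ℕ) (A : Form) (j k : ℕ)
    (h : A.freeVars ⊆ {x | x < N ∨ ∃ m < j + k, ¬ Kept K m ∧ x = N + m}) :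
    (quantify K E N A j k).freeVars ⊆ {x | x < N ∨ ∃ m < j, ¬ Kept K m ∧ x = N + m} := by
  induction k generalizing j with
  | zero => exact h
  | succ k ih =>
    have i := ih (j + 1) (by rwa [Nat.add_right_comm])
    rw [quantify]
    have sharpen : ∀ x ∈ (quantify K E N A (j + 1) k).freeVars, (Kept K j ∨ x ≠ N + j) →
        x < N ∨ ∃ m < j, ¬ Kept K m ∧ x = N + m := by
      intro x hx hj
      rcases i hx with h | ⟨m, hm, hk, rfl⟩
      · exact .inl h
      · refine .inr ⟨m, lt_of_le_of_ne (Nat.lt_succ_iff.1 hm) ?_, hk, rfl⟩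
        rintro rfl
        exact hj.elim hk fun h => h rfl
    split_ifs with hj hE
    · exact fun x hx => sharpen x hx (.inl hj)
    · exact fun x hx => sharpen x hx.1 (.inr hx.2)
    · exact fun x hx => sharpen x hx.1 (.inr hx.2)

/-- The assignment `w` agrees with `v` on variables below `N`, and assigns to the variables for the
ground terms less than `j` their values. -/
structure Matches {M : Type} [Nonempty M] (S : Sig.Structure M) (v : ℕ → M) (K K' : Set (ℕ × ℕ))
    (T : Set Bool) (N j : ℕ) (a w : ℕ → M) : Prop where
  low : ∀ x < N, w x = v x
  high : ∀ m < j, ¬ Kept K m → w (N + m) = val S v K' T a m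

section Game

variable {M : Type} [Nonempty M] {S : Sig.Structure M} {v : ℕ → M} {K K' : Set (ℕ × ℕ)}
    {T : Set Bool} {N j : ℕ} {a w : ℕ → M}

theorem Matches.succ_of_kept (h : Matches S v K K' T N j a w) (hj : Kept K j) :
    Matches S v K K' T N (j + 1) a w where
  low := h.low
  high m hm hk := h.high m (lt_of_le_of_ne (Nat.lt_succ_iff.1 hm) fun e => hk (e ▸ hj)) hk

theorem Matches.succ_val (h : Matches S v K K' T N j a w) :
    Matches S v K K' T N (j + 1) a (Function.update w (N + j) (val S v K' T a j)) where
  low x hx := by rw [Function.update_of_ne (by omega)]; exact h.low x hx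
  high m hm hk := by
    rcases Nat.lt_succ_iff_lt_or_eq.1 hm with hm | rfl
    · rw [Function.update_of_ne (by omega)]; exact h.high m hm hk
    · simp

/-- This answers the opponent's move: an uninterpreted term takes its value from `a`, so `a` can be
changed at `j` to `b`. By `val_congr` the values of earlier terms are unaffected. -/
theorem Matches.succ_arbitrary (h : Matches S v K K' T N j a w) (hj : ¬ Interpreted K' T j)
    (b : M) :
    Matches S v K K' T N (j + 1) (Function.update a j b) (Function.update w (N + j) b) := by
  have key := (h.succ_val)
  have hval : ∀ m < j, val S v K' T (Function.update a j b) m = val S v K' T a m := fun m hm =>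
    val_congr S v K' T m fun i hi => by rw [Function.update_of_ne (by omega)]
  have h' : Matches S v K K' T N j (Function.update a j b) w :=
    ⟨h.low, fun m hm hk => by rw [hval m hm]; exact h.high m hm hk⟩
  have := h'.succ_val
  rwa [val_of_not_interpreted S v K' T _ hj, Function.update_self] at this

/-- If the matrix is true for all values of the uninterpreted terms, then so is the formula with
the quantifier prefix, where the interpreted terms are existentially quantified. -/
theorem sat_quantify {E : ℕ → Prop} {A : Form}
    (hE : ∀ m, ¬ Kept K m → ¬ E m → ¬ Interpreted K' T m) (k : ℕ)
    (hA : ∀ a w, Matches S v K K' T N (j + k) a w → A.Sat S w)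
    (h : Matches S v K K' T N j a w) : (quantify K E N A j k).Sat S w := by
  induction k generalizing j a w with
  | zero => exact hA a w h
  | succ k ih =>
    have hA' : ∀ a w, Matches S v K K' T N (j + 1 + k) a w → A.Sat S w := by
      rwa [Nat.add_right_comm]
    rw [quantify]
    split_ifs with hj hEj
    · exact ih hA' (h.succ_of_kept hj)
    · exact ⟨_, ih hA' h.succ_val⟩
    · exact fun b => ih hA' (h.succ_arbitrary (hE j hj hEj) b)

/-- The dual of `sat_quantify`. -/
theorem not_sat_quantify {E : ℕ → Prop} {A : Form}
    (hE : ∀ m, ¬ Kept K m → E m → ¬ Interpreted K' T m) (k : ℕ)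
    (hA : ∀ a w, Matches S v K K' T N (j + k) a w → ¬ A.Sat S w)
    (h : Matches S v K K' T N j a w) : ¬ (quantify K E N A j k).Sat S w := by
  induction k generalizing j a w with
  | zero => exact hA a w h
  | succ k ih =>
    have hA' : ∀ a w, Matches S v K K' T N (j + 1 + k) a w → ¬ A.Sat S w := by
      rwa [Nat.add_right_comm]
    rw [quantify]
    split_ifs with hj hEj
    · exact ih hA' (h.succ_of_kept hj)
    · rintro ⟨b, hb⟩
      exact ih hA' (h.succ_arbitrary (hE j hj hEj) b) hb
    · exact fun hb => ih hA' h.succ_val (hb _)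

end Game

/-- A Skolem function belongs to one side only, and a function interpreted on both sides is shared,
so its term is kept. Thus each quantified term is arbitrary on at least one side. -/
theorem not_interpreted_of_not_kept {KF KG : Set (ℕ × ℕ)} {s s' : Bool} (hs : s ≠ s') {m : ℕ}
    (hk : ¬ Kept (KF ∩ KG) m) (h : Interpreted KF {s} m) : ¬ Interpreted KG {s'} m := by
  intro h'
  unfold Kept at hk
  rcases h with h | ⟨h1, h2⟩ | ⟨h1, r, hr, h2⟩
  · exact hk (.inl h)
  · rcases h' with h' | ⟨_, h3⟩ | ⟨h3, _⟩
    · exact hk (.inl h')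
    · exact hk (.inr ⟨h1, h2, h3⟩)
    · omega
  · rcases h' with h' | ⟨h3, _⟩ | ⟨_, r', hr', h3⟩
    · omega
    · omega
    · rw [Set.mem_singleton_iff] at hr hr'
      subst hr hr'
      rw [h2] at h3
      revert hs h3
      cases r <;> cases r' <;> simp

/-! ## Closing off superfluous variables -/

theorem termVal_congr {M : Type} (S : Sig.Structure M) {v w : ℕ → M} (t : Trm)
    (h : ∀ x ∈ t.varFinset, v x = w x) : termVal S v t = termVal S w t := by
  induction t with
  | var x => exact h x (by simp [Term.varFinset])
  | @func n f ts ih =>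
    change @Structure.funMap Sig M S n f (fun i => termVal S v (ts i)) =
      @Structure.funMap Sig M S n f (fun i => termVal S w (ts i))
    congr 1
    funext i
    exact ih i fun x hx => h x (by simp only [Term.varFinset, Finset.mem_biUnion]; exact ⟨i, by simp, hx⟩)

theorem Form.sat_congr {M : Type} (S : Sig.Structure M) (A : Form) :
    ∀ {v w : ℕ → M}, (∀ x ∈ A.freeVars, v x = w x) → (A.Sat S v ↔ A.Sat S w) := by
  induction A with
  | top | bot => intro v w _; simp [Form.Sat]
  | atom n p ts =>
    intro v w h
    have : (fun i => termVal S v (ts i)) = fun i => termVal S w (ts i) := funext fun i =>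
      termVal_congr S _ fun x hx => h x (Set.mem_iUnion.2 ⟨i, hx⟩)
    simp only [Form.Sat, AtomSat, this]
  | neg A ih => intro v w h; simp only [Form.Sat, ih h]
  | and A B ihA ihB | or A B ihA ihB | imp A B ihA ihB =>
    intro v w h
    simp only [Form.Sat, ihA fun x hx => h x (.inl hx), ihB fun x hx => h x (.inr hx)]
  | all y A ih =>
    intro v w h
    simp only [Form.Sat]
    refine forall_congr' fun b => ih fun x hx => ?_
    by_cases hxy : x = y
    · subst hxy; simp
    · simp only [Function.update_of_ne hxy]; exact h x ⟨hx, hxy⟩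
  | ex y A ih =>
    intro v w h
    simp only [Form.Sat]
    refine exists_congr fun b => ih fun x hx => ?_
    by_cases hxy : x = y
    · subst hxy; simp
    · simp only [Function.update_of_ne hxy]; exact h x ⟨hx, hxy⟩

/-- The free variables of a Horn interpolant that are not shared can be quantified. -/
theorem exists_interpolant_of_freeVars_lt {F G : Form} (N : ℕ) :
    ∀ H : Form, H.IsHorn → Entails F H → Entails H G → H.voc ⊆ F.voc ∩ G.voc →
      H.freeVars ⊆ {x | x < N ∨ x ∈ F.freeVars ∩ G.freeVars} →
      ∃ H : Form, IsCraigLyndonInterpolant F G H ∧ H.IsHorn := by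
  induction N with
  | zero =>
    intro H h1 h2 h3 h4 h5
    exact ⟨H, ⟨h2, h3, h4, fun x hx => (h5 hx).resolve_left (Nat.not_lt_zero x)⟩, h1⟩
  | succ N ih =>
    intro H h1 h2 h3 h4 h5
    have shrink : ∀ x ∈ H.freeVars, (N ∈ F.freeVars ∩ G.freeVars ∨ x ≠ N) →
        x < N ∨ x ∈ F.freeVars ∩ G.freeVars := by
      intro x hx hN
      rcases h5 hx with h | h
      · by_cases hxN : x = N
        · exact .inr (hxN ▸ hN.resolve_right fun h => h hxN)
        · exact .inl (by have : x < N + 1 := h; omega)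
      · exact .inr h
    have upd : ∀ {A : Form}, N ∉ A.freeVars → ∀ (M : Type) (S : Sig.Structure M) (v : ℕ → M) b,
        A.Sat S (Function.update v N b) ↔ A.Sat S v := fun {A} hA M S v b =>
      A.sat_congr S fun x hx => Function.update_of_ne (fun (h : x = N) => hA (h ▸ hx)) _ _
    -- A variable foreign to `F` can be generalized after `F`; one that is in `F` but foreign to `G`
    -- can be eliminated existentially before `G`.
    by_cases hF : N ∈ F.freeVars
    · by_cases hG : N ∈ G.freeVars
      · exact ih H h1 h2 h3 h4 fun x hx => shrink x hx (.inl ⟨hF, hG⟩)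
      · refine ih (.ex N H) (.ex _ _ h1) (fun M _ S v hv => ⟨v N, ?_⟩) (fun M _ S v hv => ?_) h4
          fun x hx => shrink x hx.1 (.inr hx.2)
        · rw [Function.update_eq_self]; exact h2 M S v hv
        · obtain ⟨b, hb⟩ := hv
          exact (upd hG M S v b).1 (h3 M S _ hb)
    · refine ih (.all N H) (.all _ _ h1) (fun M _ S v hv b => ?_) (fun M _ S v hv => ?_) h4
        fun x hx => shrink x hx.1 (.inr hx.2)
      · exact h2 M S _ ((upd hF M S v b).2 hv)
      · have := hv (v N)
        rw [Function.update_eq_self] at this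
        exact h3 M S v this

/-- Craig-Lyndon interpolation from a Horn formula. -/
theorem Form.IsHorn.exists_interpolant {F G : Form} (hF : F.IsHorn) (h : Entails F G) :
    ∃ H : Form, IsCraigLyndonInterpolant F G H ∧ H.IsHorn := by
  obtain ⟨U, hU⟩ := h.exists_expansion
  obtain ⟨I, hI, hFI, hIG⟩ := hF.exists_ground_interpolant hU
  obtain ⟨N, hN⟩ := exists_below I
  set K := F.funs ∩ G.funs
  -- Terms that the side of `F` can evaluate become existential, as `F` supplies their values; all
  -- others become universal.
  set H := quantify K (Interpreted F.funs {true}) N (matrixForm K N I) 0 N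
  have hinit : ∀ {M : Type} [Nonempty M] (S : Sig.Structure M) (v : ℕ → M) K' T,
      Matches S v K K' T N 0 v v := fun S v K' T => ⟨fun _ _ => rfl, fun m hm => by omega⟩
  have hv : ∀ {M : Type} [Nonempty M] (S : Sig.Structure M) (v : ℕ → M) K' T a,
      (fun x => val S v K' T a (look [] x)) = v := fun S v K' T a => by
    funext x; rw [look_nil, val_parT]
  refine exists_interpolant_of_freeVars_lt N H ?_ ?_ ?_ ?_ ?_
  · exact isHorn_quantify _ _ _ (isHorn_matrixForm K N I) _ _
  · intro M _ S v hS
    -- For `F` the universal variables are by definition those of uninterpreted terms.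
    refine sat_quantify (K' := F.funs) (T := {true}) (fun m _ hm => hm) N (fun a w hw => ?_)
      (hinit S v _ _)
    rw [Nat.zero_add] at hw
    rw [sat_matrixForm S v Set.inter_subset_left {true} a w hw.low hw.high I hN]
    exact hFI _ ((F.ev_inducedVal S v _ _ a (Set.mem_singleton true) U subset_rfl []).1
      (by rwa [hv]))
  · intro M _ S v hS
    by_contra hG
    -- For `G` the roles are exchanged: the existential variables stand for terms uninterpreted on
    -- this side.
    refine not_sat_quantify (K' := G.funs) (T := {false})
      (fun m hm hE => not_interpreted_of_not_kept (by simp) hm hE) N (fun a w hw => ?_)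
      (hinit S v _ _) hS
    rw [Nat.zero_add] at hw
    rw [sat_matrixForm S v Set.inter_subset_right {false} a w hw.low hw.high I hN]
    intro hc
    have := (G.ev_inducedVal S v _ _ a (Set.mem_singleton false) U subset_rfl []).2 (hIG _ hc)
    rw [hv] at this
    exact hG this
  · have hfuns : H.funs ⊆ F.funs ∩ G.funs := by
      rw [funs_quantify]; exact funs_matrixForm K N I
    have hpreds : H.predsAt true ⊆ F.predsAt true ∩ G.predsAt true := by
      rw [predsAt_quantify]; exact predsAt_matrixForm K N I _ hI
    refine Set.subset_inter ?_ ?_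
    · exact Set.union_subset_union (Set.image_mono fun x hx => (hfuns hx).1)
        (Set.image_mono fun x hx => (hpreds hx).1)
    · exact Set.union_subset_union (Set.image_mono fun x hx => (hfuns hx).2)
        (Set.image_mono fun x hx => (hpreds hx).2)
  · refine (freeVars_quantify _ _ _ _ 0 N ?_).trans ?_
    · rw [Nat.zero_add]; exact freeVars_matrixForm K N I hN
    · rintro x (hx | ⟨m, hm, _⟩)
      · exact .inl hx
      · omega

/-! ## Primitive recursion along a measure -/

section BoundedRec

variable {β σ : Type}

/-- Recursion in which the value at `b` is obtained by `g` from the values at those elements of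
`l b` whose measure is smaller. -/
def boundedRec (m : β → ℕ) (l : β → List β) (g : β → List σ → σ) (b : β) : σ :=
  g b (((l b).filter fun b' => m b' < m b).attach.map fun b' => boundedRec m l g b'.1)
termination_by m b
decreasing_by simpa using (List.mem_filter.1 b'.2).2

/-- The filter in the definition only secures termination; under `hl` it removes nothing. -/
theorem boundedRec_eq {m : β → ℕ} {l : β → List β} (g : β → List σ → σ)
    (hl : ∀ b, ∀ b' ∈ l b, m b' < m b) (b : β) :
    boundedRec m l g b = g b ((l b).map (boundedRec m l g)) := by
  have : (l b).filter (fun b' => m b' < m b) = l b :=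
    List.filter_eq_self.2 fun b' hb' => by simpa using hl b b' hb'
  rw [boundedRec, List.attach_map_val (f := boundedRec m l g), this]

theorem primrec_boundedRec [Primcodable β] [Primcodable σ] {m : β → ℕ} {l : β → List β}
    {g : β → List σ → σ} (hl : ∀ b, ∀ b' ∈ l b, m b' < m b) (pm : Primrec m) (pl : Primrec l)
    (pg : Primrec₂ g) : Primrec (boundedRec m l g) :=
  Primrec.nat_omega_rec' (boundedRec m l g) pm pl (g := fun b rs => some (g b rs))
    (Primrec₂.option_some_iff.2 pg) hl fun b => by rw [boundedRec_eq g hl]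

end BoundedRec

/-! ### Primitive recursive operations on lists and pairs. -/

section Primrec

variable {α β σ : Type} [Primcodable α] [Primcodable β] [Primcodable σ]

theorem primrec_ite_eq {f : α → ℕ} {g h : α → σ} (k : ℕ) (hf : Primrec f) (hg : Primrec g)
    (hh : Primrec h) : Primrec fun a => if f a = k then g a else h a :=
  Primrec.ite (Primrec.eq.comp hf (Primrec.const k)) hg hh

theorem primrecRel_mem : PrimrecRel fun (a : α) (L : List α) => a ∈ L :=
  ((Primrec.eq.exists_mem_list (α := α)).comp Primrec.snd Primrec.fst).of_eq fun x => by simp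

theorem primrec_decide_mem {f : β → α} {L : β → List α} [∀ b, Decidable (f b ∈ L b)] (hf : Primrec f)
    (hL : Primrec L) : Primrec fun b => decide (f b ∈ L b) :=
  primrecPred_iff_primrec_decide.1 (primrecRel_mem.comp hf hL)

theorem primrec_sublists' : Primrec (List.sublists' : List α → List (List α)) := by
  have h : Primrec fun l : List α => l.foldr (fun a L => L ++ L.map (a :: ·)) [[]] :=
    Primrec.list_foldr Primrec.id (Primrec.const [[]])
      (Primrec.list_append.comp (Primrec.snd.comp Primrec.snd)
        (Primrec.list_map (Primrec.snd.comp Primrec.snd)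
          (Primrec.list_cons.comp (Primrec.fst.comp (Primrec.snd.comp Primrec.fst))
            Primrec.snd).to₂)).to₂
  refine h.of_eq fun l => ?_
  induction l with
  | nil => rfl
  | cons a l ih => rw [List.foldr_cons, ih, List.sublists'_cons]

theorem primrec_unpair₁ {f : α → ℕ} (hf : Primrec f) : Primrec fun a => (f a).unpair.1 :=
  Primrec.fst.comp (Primrec.unpair.comp hf)

theorem primrec_unpair₂ {f : α → ℕ} (hf : Primrec f) : Primrec fun a => (f a).unpair.2 :=
  Primrec.snd.comp (Primrec.unpair.comp hf)

theorem primrec_argsOf : Primrec argsOf :=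
  (Primrec.ofNat (List ℕ)).comp (primrec_unpair₂ (primrec_unpair₂ Primrec.id))

end Primrec

/-! ## Term codes -/

theorem primrec_look : Primrec₂ look :=
  Primrec.option_getD.comp (Primrec.listLookup.comp Primrec.snd Primrec.fst)
    (Primrec₂.natPair.comp (Primrec.const 0) Primrec.snd)

theorem primrec_fnT : Primrec₂ fnT :=
  Primrec₂.natPair.comp (Primrec.const 1)
    (Primrec₂.natPair.comp Primrec.fst (Primrec.encode.comp Primrec.snd))

theorem argsOf_pair (k f : ℕ) (ts : List ℕ) :
    argsOf (Nat.pair k (Nat.pair f (Encodable.encode ts))) = ts := by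
  simp [argsOf]

/-- The ground instance of a term, in terms of Gödel numbers. -/
def instC : List (ℕ × ℕ) × ℕ → ℕ :=
  boundedRec Prod.snd (fun b => (argsOf b.2).map fun t => (b.1, t))
    fun b rs => if b.2.unpair.1 = 0 then look b.1 b.2.unpair.2 else fnT b.2.unpair.2.unpair.1 rs

theorem instC_measure (b : List (ℕ × ℕ) × ℕ) :
    ∀ b' ∈ (argsOf b.2).map fun t => (b.1, t), b'.2 < b.2 := by
  intro b' hb'
  obtain ⟨t, ht, rfl⟩ := List.mem_map.1 hb'
  exact lt_of_mem_argsOf ht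

theorem instC_termCode (σ : List (ℕ × ℕ)) (t : Trm) : instC (σ, termCode t) = inst σ t := by
  induction t with
  | var x => rw [instC, boundedRec_eq _ instC_measure]; simp [termCode, inst]
  | @func n f ts ih =>
    rw [instC, boundedRec_eq _ instC_measure]
    have ih' : ∀ i, boundedRec Prod.snd (fun b : List (ℕ × ℕ) × ℕ => (argsOf b.2).map fun t => (b.1, t))
        (fun b rs => if b.2.unpair.1 = 0 then look b.1 b.2.unpair.2
          else fnT b.2.unpair.2.unpair.1 rs) (σ, termCode (ts i)) = inst σ (ts i) := ih
    simp [termCode, argsOf_pair, inst, List.map_ofFn, Function.comp_def, ih']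

theorem primrec_instC : Primrec instC :=
  primrec_boundedRec instC_measure Primrec.snd
    (Primrec.list_map (primrec_argsOf.comp Primrec.snd)
      (Primrec.pair (Primrec.fst.comp Primrec.fst) Primrec.snd).to₂)
    (primrec_ite_eq 0 (primrec_unpair₁ (Primrec.snd.comp Primrec.fst))
      (primrec_look.comp (Primrec.fst.comp Primrec.fst)
        (primrec_unpair₂ (Primrec.snd.comp Primrec.fst)))
      (primrec_fnT.comp (primrec_unpair₁ (primrec_unpair₂ (Primrec.snd.comp Primrec.fst)))
        Primrec.snd)).to₂

theorem argsOf_measure (t : ℕ) : ∀ t' ∈ argsOf t, id t' < id t := fun _ h => lt_of_mem_argsOf h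

/-- The functions of a term, in terms of Gödel numbers. -/
def termFunsC : ℕ → List (ℕ × ℕ) :=
  boundedRec id argsOf fun t rs =>
    if t.unpair.1 = 0 then [] else ((argsOf t).length, t.unpair.2.unpair.1) :: rs.flatten

theorem mem_termFunsC (t : Trm) (x : ℕ × ℕ) : x ∈ termFunsC (termCode t) ↔ x ∈ termFuns t := by
  induction t with
  | var y => rw [termFunsC, boundedRec_eq _ argsOf_measure]; simp [termCode, termFuns]
  | @func n f ts ih =>
    rw [termFunsC, boundedRec_eq _ argsOf_measure]
    change _ ↔ x ∈ insert (n, f) (⋃ i, termFuns (ts i))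
    rw [Set.mem_insert_iff, Set.mem_iUnion, ← exists_congr ih]
    simp [termCode, argsOf_pair, termFunsC]

theorem primrec_termFunsC : Primrec termFunsC :=
  primrec_boundedRec argsOf_measure Primrec.id primrec_argsOf
    (primrec_ite_eq 0 (primrec_unpair₁ Primrec.fst) (Primrec.const [])
      (Primrec.list_cons.comp
        (Primrec.pair (Primrec.list_length.comp (primrec_argsOf.comp Primrec.fst))
          (primrec_unpair₁ (primrec_unpair₂ Primrec.fst)))
        (Primrec.list_flatten.comp Primrec.snd))).to₂

/-- The variables of a term, in terms of Gödel numbers. -/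
def termVarsC : ℕ → List ℕ :=
  boundedRec id argsOf fun t rs => if t.unpair.1 = 0 then [t.unpair.2] else rs.flatten

theorem mem_termVarsC (t : Trm) (x : ℕ) : x ∈ termVarsC (termCode t) ↔ x ∈ t.varFinset := by
  induction t with
  | var y => rw [termVarsC, boundedRec_eq _ argsOf_measure]; simp [termCode, Term.varFinset]
  | @func n f ts ih =>
    rw [termVarsC, boundedRec_eq _ argsOf_measure]
    simp only [Term.varFinset, Finset.mem_biUnion, Finset.mem_univ, true_and]
    rw [← exists_congr ih]
    simp [termCode, argsOf_pair, termVarsC]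

theorem primrec_termVarsC : Primrec termVarsC :=
  primrec_boundedRec argsOf_measure Primrec.id primrec_argsOf
    (primrec_ite_eq 0 (primrec_unpair₁ Primrec.fst)
      (Primrec.list_cons.comp (primrec_unpair₂ Primrec.fst) (Primrec.const []))
      (Primrec.list_flatten.comp Primrec.snd)).to₂

/-- Decides whether a number is the Gödel number of a term. -/
def isTermC : ℕ → Bool :=
  boundedRec id argsOf fun t rs =>
    if t.unpair.1 = 0 then true else if t.unpair.1 = 1 then decide (false ∉ rs) else false

theorem isTermC_termCode (t : Trm) : isTermC (termCode t) = true := by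
  induction t with
  | var y => rw [isTermC, boundedRec_eq _ argsOf_measure]; simp [termCode]
  | @func n f ts ih =>
    rw [isTermC, boundedRec_eq _ argsOf_measure]
    have ih' : ∀ i, isTermC (termCode (ts i)) ≠ false := fun i => by simp [ih i]
    simpa [termCode, argsOf_pair, isTermC] using ih'

theorem exists_args_of_forall_exists {ts : List ℕ} (h : ∀ t ∈ ts, ∃ u : Trm, termCode u = t) :
    ∃ us : Fin ts.length → Trm, (List.ofFn fun i => termCode (us i)) = ts := by
  choose us hus using fun i : Fin ts.length => h (ts.get i) (List.get_mem _ _)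
  exact ⟨us, by simp only [hus]; exact List.ofFn_get ts⟩

/-- Every number decodes to some list, so correct tags suffice: the arguments are rebuilt
recursively and the arity is the length of the list. -/
theorem exists_termCode_eq (c : ℕ) (h : isTermC c = true) : ∃ t : Trm, termCode t = c := by
  induction c using Nat.strong_induction_on with
  | _ c ih =>
    rw [isTermC, boundedRec_eq _ argsOf_measure] at h
    split_ifs at h with h0 h1
    · exact ⟨.var c.unpair.2, by rw [termCode, ← h0, Nat.pair_unpair]⟩
    · have hargs : ∀ t ∈ argsOf c, ∃ u : Trm, termCode u = t := by
        intro t ht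
        refine ih t (lt_of_mem_argsOf ht) ?_
        by_contra hc
        rw [Bool.not_eq_true] at hc
        simp only [decide_eq_true_eq, List.mem_map, not_exists, not_and] at h
        exact h t ht hc
      obtain ⟨us, hus⟩ := exists_args_of_forall_exists hargs
      refine ⟨.func (L := Sig) (l := (argsOf c).length) c.unpair.2.unpair.1 us, ?_⟩
      rw [termCode, hus, argsOf, Denumerable.encode_ofNat, Nat.pair_unpair, ← h1, Nat.pair_unpair]

theorem primrec_isTermC : Primrec isTermC :=
  primrec_boundedRec argsOf_measure Primrec.id primrec_argsOf
    (primrec_ite_eq 0 (primrec_unpair₁ Primrec.fst) (Primrec.const true)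
      (primrec_ite_eq 1 (primrec_unpair₁ Primrec.fst)
        (primrecPred_iff_primrec_decide.1
          (primrecRel_mem.comp (Primrec.const false) Primrec.snd).not)
        (Primrec.const false))).to₂

/-! ## Formula codes -/

/-- Tag `0` must be excluded, since the second component of `0` is `0`; accordingly `subCodes` is
empty for it. -/
theorem unpair_two_lt {c : ℕ} (h : c.unpair.1 ≠ 0) : c.unpair.2 < c := by
  conv_rhs => rw [← Nat.pair_unpair c]
  generalize c.unpair.1 = a at h
  generalize c.unpair.2 = b
  rw [Nat.pair]
  split_ifs with hab
  · have := Nat.le_mul_self b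
    omega
  · have : 0 < a := Nat.pos_of_ne_zero h
    nlinarith

/-- Candidates for the codes of the immediate subformulas. -/
def subCodes (c : ℕ) : List ℕ :=
  if c.unpair.1 = 0 then [] else [c.unpair.2, c.unpair.2.unpair.1, c.unpair.2.unpair.2]

theorem subCodes_measure (c : ℕ) : ∀ c' ∈ subCodes c, id c' < id c := by
  intro c' h
  rw [subCodes] at h
  split_ifs at h with h0
  · simp at h
  · have := unpair_two_lt h0
    have h1 := Nat.unpair_left_le c.unpair.2
    have h2 := Nat.unpair_right_le c.unpair.2
    simp only [List.mem_cons, List.not_mem_nil, or_false] at h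
    simp only [id]
    omega

theorem primrec_subCodes : Primrec subCodes :=
  primrec_ite_eq 0 (primrec_unpair₁ Primrec.id) (Primrec.const [])
    (Primrec.list_cons.comp (primrec_unpair₂ Primrec.id)
      (Primrec.list_cons.comp (primrec_unpair₁ (primrec_unpair₂ Primrec.id))
        (Primrec.list_cons.comp (primrec_unpair₂ (primrec_unpair₂ Primrec.id))
          (Primrec.const []))))

/-- Recursion on formula codes. The step function `g` is given the values at `b`, at the first and
at the second component of `b`, where `b` is the second component of the code. -/
def codeRec {σ : Type} (d : σ) (g : ℕ → σ → σ → σ → σ) : ℕ → σ :=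
  boundedRec id subCodes fun c rs => g c (rs.getD 0 d) (rs.getD 1 d) (rs.getD 2 d)

section CodeRec

variable {σ : Type} (d : σ) (g : ℕ → σ → σ → σ → σ)

theorem codeRec_zero (b : ℕ) : codeRec d g (Nat.pair 0 b) = g (Nat.pair 0 b) d d d := by
  rw [codeRec, boundedRec_eq _ subCodes_measure]
  simp [subCodes]

theorem codeRec_pair {k : ℕ} (hk : k ≠ 0) (b : ℕ) :
    codeRec d g (Nat.pair k b) = g (Nat.pair k b) (codeRec d g b) (codeRec d g b.unpair.1)
      (codeRec d g b.unpair.2) := by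
  rw [codeRec, boundedRec_eq _ subCodes_measure]
  simp [subCodes, hk]

theorem primrec_codeRec [Primcodable σ]
    (hg : Primrec fun x : ℕ × σ × σ × σ => g x.1 x.2.1 x.2.2.1 x.2.2.2) :
    Primrec (codeRec d g) := by
  refine primrec_boundedRec subCodes_measure Primrec.id primrec_subCodes ?_
  have hr : ∀ i : ℕ, Primrec fun x : ℕ × List σ => x.2.getD i d := fun i =>
    (Primrec.list_getD d).comp Primrec.snd (Primrec.const i)
  exact hg.comp (Primrec.pair Primrec.fst (Primrec.pair (hr 0) (Primrec.pair (hr 1) (hr 2))))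

end CodeRec

/-- The functions of a formula, in terms of Gödel numbers. -/
def funsC : ℕ → List (ℕ × ℕ) :=
  codeRec [] fun c r r₁ r₂ =>
    if c.unpair.1 = 0 then [] else if c.unpair.1 = 1 then []
    else if c.unpair.1 = 2 then (argsOf c).flatMap termFunsC
    else if c.unpair.1 = 3 then r
    else if c.unpair.1 = 7 then r₂ else if c.unpair.1 = 8 then r₂
    else r₁ ++ r₂

theorem mem_funsC (A : Form) (x : ℕ × ℕ) : x ∈ funsC A.code ↔ x ∈ A.funs := by
  induction A with
  | top => rw [Form.code, funsC, codeRec_zero]; simp [Form.funs]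
  | bot => rw [Form.code, funsC, codeRec_pair _ _ (by simp)]; simp [Form.funs]
  | atom n p ts =>
    rw [Form.code, funsC, codeRec_pair _ _ (by simp)]
    simp [Form.funs, argsCode, argsOf_pair, mem_termFunsC]
  | neg A ih =>
    rw [Form.code, funsC, codeRec_pair _ _ (by simp), ← funsC]; simpa [Form.funs] using ih
  | and A B ihA ihB | or A B ihA ihB | imp A B ihA ihB =>
    rw [Form.code, funsC, codeRec_pair _ _ (by simp), ← funsC]; simp [Form.funs, ihA, ihB]
  | all y A ih | ex y A ih =>
    rw [Form.code, funsC, codeRec_pair _ _ (by simp), ← funsC]; simpa [Form.funs] using ih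

theorem primrec_funsC : Primrec funsC := by
  have ht : Primrec fun x : ℕ × List (ℕ × ℕ) × List (ℕ × ℕ) × List (ℕ × ℕ) => x.1.unpair.1 :=
    primrec_unpair₁ Primrec.fst
  have h2 : Primrec fun x : ℕ × List (ℕ × ℕ) × List (ℕ × ℕ) × List (ℕ × ℕ) => x.2.2.2 :=
    Primrec.snd.comp (Primrec.snd.comp Primrec.snd)
  exact primrec_codeRec _ _ <|
    primrec_ite_eq 0 ht (Primrec.const []) <| primrec_ite_eq 1 ht (Primrec.const []) <|
    primrec_ite_eq 2 ht (Primrec.list_flatMap (primrec_argsOf.comp Primrec.fst)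
      (primrec_termFunsC.comp Primrec.snd).to₂) <|
    primrec_ite_eq 3 ht (Primrec.fst.comp Primrec.snd) <|
    primrec_ite_eq 7 ht h2 <| primrec_ite_eq 8 ht h2 <|
    Primrec.list_append.comp (Primrec.fst.comp (Primrec.snd.comp Primrec.snd)) h2

/-- The free variables of a formula, in terms of Gödel numbers. -/
def freeVarsC : ℕ → List ℕ :=
  codeRec [] fun c r r₁ r₂ =>
    if c.unpair.1 = 0 then [] else if c.unpair.1 = 1 then []
    else if c.unpair.1 = 2 then (argsOf c).flatMap termVarsC
    else if c.unpair.1 = 3 then r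
    else if c.unpair.1 = 7 then r₂.filter fun y => ¬ y = c.unpair.2.unpair.1
    else if c.unpair.1 = 8 then r₂.filter fun y => ¬ y = c.unpair.2.unpair.1
    else r₁ ++ r₂

theorem mem_freeVarsC (A : Form) (x : ℕ) : x ∈ freeVarsC A.code ↔ x ∈ A.freeVars := by
  induction A with
  | top => rw [Form.code, freeVarsC, codeRec_zero]; simp [Form.freeVars]
  | bot => rw [Form.code, freeVarsC, codeRec_pair _ _ (by simp)]; simp [Form.freeVars]
  | atom n p ts =>
    rw [Form.code, freeVarsC, codeRec_pair _ _ (by simp)]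
    simp [Form.freeVars, argsCode, argsOf_pair, mem_termVarsC]
  | neg A ih =>
    rw [Form.code, freeVarsC, codeRec_pair _ _ (by simp), ← freeVarsC]
    simpa [Form.freeVars] using ih
  | and A B ihA ihB | or A B ihA ihB | imp A B ihA ihB =>
    rw [Form.code, freeVarsC, codeRec_pair _ _ (by simp), ← freeVarsC]
    simp [Form.freeVars, ihA, ihB]
  | all y A ih | ex y A ih =>
    rw [Form.code, freeVarsC, codeRec_pair _ _ (by simp), ← freeVarsC]
    simp [Form.freeVars, ih]

theorem primrec_freeVarsC : Primrec freeVarsC := by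
  have ht : Primrec fun x : ℕ × List ℕ × List ℕ × List ℕ => x.1.unpair.1 :=
    primrec_unpair₁ Primrec.fst
  have h2 : Primrec fun x : ℕ × List ℕ × List ℕ × List ℕ => x.2.2.2 :=
    Primrec.snd.comp (Primrec.snd.comp Primrec.snd)
  have hf : Primrec fun x : ℕ × List ℕ × List ℕ × List ℕ =>
      x.2.2.2.filter fun y => ¬ y = x.1.unpair.2.unpair.1 :=
    (PrimrecRel.listFilter (R := fun y z : ℕ => ¬ y = z) Primrec.eq.not).comp h2
      (primrec_unpair₁ (primrec_unpair₂ Primrec.fst))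
  exact primrec_codeRec _ _ <|
    primrec_ite_eq 0 ht (Primrec.const []) <| primrec_ite_eq 1 ht (Primrec.const []) <|
    primrec_ite_eq 2 ht (Primrec.list_flatMap (primrec_argsOf.comp Primrec.fst)
      (primrec_termVarsC.comp Primrec.snd).to₂) <|
    primrec_ite_eq 3 ht (Primrec.fst.comp Primrec.snd) <|
    primrec_ite_eq 7 ht hf <| primrec_ite_eq 8 ht hf <|
    Primrec.list_append.comp (Primrec.fst.comp (Primrec.snd.comp Primrec.snd)) h2

/-- Reversing the context flips every polarity, so a recursion that computes only the positive
context suffices. -/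
theorem Form.mem_predsAt_not (A : Form) (pol : Bool) (q : ℕ × ℕ) (b : Bool) :
    (q, b) ∈ A.predsAt (!pol) ↔ (q, !b) ∈ A.predsAt pol := by
  induction A generalizing pol with
  | top | bot => simp [Form.predsAt]
  | atom n p ts => cases pol <;> cases b <;> simp [Form.predsAt]
  | neg A ih => exact ih (!pol)
  | and A B ihA ihB | or A B ihA ihB | imp A B ihA ihB =>
    simp only [Form.predsAt, Set.mem_union, ihA, ihB]
  | all y A ih | ex y A ih => exact ih pol

/-- Exchange of the polarities of predicates. -/
def flipPol (L : List ((ℕ × ℕ) × Bool)) : List ((ℕ × ℕ) × Bool) := L.map fun x => (x.1, !x.2)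

theorem mem_flipPol (L : List ((ℕ × ℕ) × Bool)) (q : ℕ × ℕ) (b : Bool) :
    (q, b) ∈ flipPol L ↔ (q, !b) ∈ L := by
  cases b <;> simp [flipPol]

theorem primrec_flipPol : Primrec flipPol :=
  Primrec.list_map Primrec.id (Primrec.pair (Primrec.fst.comp Primrec.snd)
    (Primrec.not.comp (Primrec.snd.comp Primrec.snd))).to₂

/-- The predicates of a formula with their polarities, in terms of Gödel numbers. -/
def predsC : ℕ → List ((ℕ × ℕ) × Bool) :=
  codeRec [] fun c r r₁ r₂ =>
    if c.unpair.1 = 0 then [] else if c.unpair.1 = 1 then []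
    else if c.unpair.1 = 2 then [(((argsOf c).length, c.unpair.2.unpair.1), true)]
    else if c.unpair.1 = 3 then flipPol r
    else if c.unpair.1 = 6 then flipPol r₁ ++ r₂
    else if c.unpair.1 = 7 then r₂ else if c.unpair.1 = 8 then r₂
    else r₁ ++ r₂

theorem mem_predsC (A : Form) (x : (ℕ × ℕ) × Bool) :
    x ∈ predsC A.code ↔ x ∈ A.predsAt true := by
  obtain ⟨q, b⟩ := x
  have hn : ∀ (A : Form) (b : Bool), (q, b) ∈ A.predsAt false ↔ (q, !b) ∈ A.predsAt true :=
    fun A b => A.mem_predsAt_not true q b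
  induction A generalizing b with
  | top => rw [Form.code, predsC, codeRec_zero]; simp [Form.predsAt]
  | bot => rw [Form.code, predsC, codeRec_pair _ _ (by simp)]; simp [Form.predsAt]
  | atom n p ts =>
    rw [Form.code, predsC, codeRec_pair _ _ (by simp)]
    simp [Form.predsAt, argsCode, argsOf_pair]
  | neg A ih =>
    rw [Form.code, predsC, codeRec_pair _ _ (by simp), ← predsC]
    simp [Form.predsAt, mem_flipPol, ih, hn]
  | and A B ihA ihB | or A B ihA ihB | imp A B ihA ihB =>
    rw [Form.code, predsC, codeRec_pair _ _ (by simp), ← predsC]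
    simp [Form.predsAt, mem_flipPol, ihA, ihB, hn]
  | all y A ih | ex y A ih =>
    rw [Form.code, predsC, codeRec_pair _ _ (by simp), ← predsC]
    simpa [Form.predsAt] using ih b

theorem primrec_predsC : Primrec predsC := by
  let X := ℕ × List ((ℕ × ℕ) × Bool) × List ((ℕ × ℕ) × Bool) × List ((ℕ × ℕ) × Bool)
  have ht : Primrec fun x : X => x.1.unpair.1 := primrec_unpair₁ Primrec.fst
  have h1 : Primrec fun x : X => x.2.2.1 := Primrec.fst.comp (Primrec.snd.comp Primrec.snd)
  have h2 : Primrec fun x : X => x.2.2.2 := Primrec.snd.comp (Primrec.snd.comp Primrec.snd)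
  exact primrec_codeRec _ _ <|
    primrec_ite_eq 0 ht (Primrec.const []) <| primrec_ite_eq 1 ht (Primrec.const []) <|
    primrec_ite_eq 2 ht (Primrec.list_cons.comp (Primrec.pair (Primrec.pair
      (Primrec.list_length.comp (primrec_argsOf.comp Primrec.fst))
      (primrec_unpair₁ (primrec_unpair₂ Primrec.fst))) (Primrec.const true)) (Primrec.const [])) <|
    primrec_ite_eq 3 ht (primrec_flipPol.comp (Primrec.fst.comp Primrec.snd)) <|
    primrec_ite_eq 6 ht (Primrec.list_append.comp (primrec_flipPol.comp h1) h2) <|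
    primrec_ite_eq 7 ht h2 <| primrec_ite_eq 8 ht h2 <|
    Primrec.list_append.comp h1 h2

/-! ### Recognition of the codes of Horn formulas. -/

/-- Classification of numbers: `0` for the codes of clauses without positive literals, `1` for
the codes of clauses with one positive literal, `2` for the codes of other Horn formulas and `3`
for all other numbers. -/
def hornC : ℕ → ℕ :=
  codeRec 3 fun c r r₁ r₂ =>
    if c.unpair.1 = 0 then if c.unpair.2 = 0 then 2 else 3
    else if c.unpair.1 = 1 then if c.unpair.2 = 0 then 0 else 3
    else if c.unpair.1 = 2 then if false ∈ (argsOf c).map isTermC then 3 else 1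
    else if c.unpair.1 = 3 then if c.unpair.2.unpair.1 = 2 then if r = 1 then 0 else 3 else 3
    else if c.unpair.1 = 4 then if r₁ ≤ 2 ∧ r₂ ≤ 2 then 2 else 3
    else if c.unpair.1 = 5 then if r₁ + r₂ ≤ 1 then r₁ + r₂ else 3
    else if c.unpair.1 = 7 then if r₂ ≤ 2 then 2 else 3
    else if c.unpair.1 = 8 then if r₂ ≤ 2 then 2 else 3
    else 3

theorem primrec_hornC : Primrec hornC := by
  let X := ℕ × ℕ × ℕ × ℕ
  have ht : Primrec fun x : X => x.1.unpair.1 := primrec_unpair₁ Primrec.fst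
  have hb : Primrec fun x : X => x.1.unpair.2 := primrec_unpair₂ Primrec.fst
  have h1 : Primrec fun x : X => x.2.2.1 := Primrec.fst.comp (Primrec.snd.comp Primrec.snd)
  have h2 : Primrec fun x : X => x.2.2.2 := Primrec.snd.comp (Primrec.snd.comp Primrec.snd)
  have c : ∀ k : ℕ, Primrec fun _ : X => k := Primrec.const
  have hq : Primrec fun x : X => if x.2.2.2 ≤ 2 then 2 else 3 :=
    Primrec.ite (Primrec.nat_le.comp h2 (c 2)) (c 2) (c 3)
  exact primrec_codeRec _ _ <|
    primrec_ite_eq 0 ht (primrec_ite_eq 0 hb (c 2) (c 3)) <|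
    primrec_ite_eq 1 ht (primrec_ite_eq 0 hb (c 0) (c 3)) <|
    primrec_ite_eq 2 ht (Primrec.ite (primrecRel_mem.comp (Primrec.const false)
      (Primrec.list_map (primrec_argsOf.comp Primrec.fst)
        (primrec_isTermC.comp Primrec.snd).to₂)) (c 3) (c 1)) <|
    primrec_ite_eq 3 ht (primrec_ite_eq 2 (primrec_unpair₁ hb)
      (primrec_ite_eq 1 (Primrec.fst.comp Primrec.snd) (c 0) (c 3)) (c 3)) <|
    primrec_ite_eq 4 ht (Primrec.ite ((Primrec.nat_le.comp h1 (c 2)).and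
      (Primrec.nat_le.comp h2 (c 2))) (c 2) (c 3)) <|
    primrec_ite_eq 5 ht (Primrec.ite (Primrec.nat_le.comp (Primrec.nat_add.comp h1 h2) (c 1))
      (Primrec.nat_add.comp h1 h2) (c 3)) <|
    primrec_ite_eq 7 ht hq <| primrec_ite_eq 8 ht hq (c 3)

theorem hornC_atom (n p : ℕ) (ts : Fin n → Trm) : hornC (Form.atom n p ts).code = 1 := by
  rw [Form.code, hornC, codeRec_pair _ _ (by simp)]
  simp [argsCode, argsOf_pair, isTermC_termCode]

theorem Form.IsClause.hornC_code {C : Form} (hC : C.IsClause) (h : C.numPos ≤ 1) :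
    hornC C.code = C.numPos := by
  induction C with
  | bot => rw [Form.code, hornC, codeRec_pair _ _ (by simp)]; simp [Form.numPos]
  | atom n p ts => exact hornC_atom n p ts
  | neg A =>
    cases A with
    | atom n p ts =>
      have := hornC_atom n p ts
      rw [Form.code, hornC, codeRec_pair _ _ (by simp), ← hornC, this]
      simp [Form.code, Form.numPos]
    | _ => exact hC.elim
  | or A B ihA ihB =>
    simp only [Form.numPos] at h ⊢
    rw [Form.code, hornC, codeRec_pair _ _ (by simp), ← hornC]
    simp [ihA hC.1 (by omega), ihB hC.2 (by omega), h]
  | top | and | imp | all | ex => exact hC.elim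

theorem Form.IsHorn.hornC_code {F : Form} (hF : F.IsHorn) : hornC F.code ≤ 2 := by
  induction hF with
  | clause C hC h => rw [hC.hornC_code h]; omega
  | top => rw [Form.code, hornC, codeRec_zero]; simp
  | and A B _ _ ihA ihB =>
    rw [Form.code, hornC, codeRec_pair _ _ (by simp), ← hornC]; simp [ihA, ihB]
  | all x A _ ih | ex x A _ ih =>
    rw [Form.code, hornC, codeRec_pair _ _ (by simp), ← hornC]; simp [ih]

/-- The last conjunct strengthens the induction: clauses are assembled from clauses with known
numbers of positive literals, for which being Horn is not enough. -/
theorem exists_isHorn_of_hornC (c : ℕ) (hc : hornC c ≤ 2) :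
    ∃ F : Form, F.code = c ∧ F.IsHorn ∧ (hornC c ≤ 1 → F.IsClause ∧ F.numPos = hornC c) := by
  induction c using Nat.strong_induction_on with
  | _ c ih =>
    have clause : ∀ C : Form, C.code = c → C.IsClause → C.numPos = hornC c → hornC c ≤ 1 →
        ∃ F : Form, F.code = c ∧ F.IsHorn ∧
          (hornC c ≤ 1 → F.IsClause ∧ F.numPos = hornC c) := fun C h1 h2 h3 h4 =>
      ⟨C, h1, .clause C h2 (h3.trans_le h4), fun _ => ⟨h2, h3⟩⟩
    have horn : ∀ F : Form, F.code = c → F.IsHorn → hornC c = 2 →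
        ∃ F : Form, F.code = c ∧ F.IsHorn ∧
          (hornC c ≤ 1 → F.IsClause ∧ F.numPos = hornC c) := fun F h1 h2 h3 =>
      ⟨F, h1, h2, fun h => by omega⟩
    obtain ⟨k, b, rfl⟩ : ∃ k b, c = Nat.pair k b := ⟨_, _, (Nat.pair_unpair c).symm⟩
    obtain ⟨x, y, rfl⟩ : ∃ x y, b = Nat.pair x y := ⟨_, _, (Nat.pair_unpair b).symm⟩
    by_cases hk0 : k = 0
    · subst hk0
      have e : hornC (Nat.pair 0 (Nat.pair x y)) = if Nat.pair x y = 0 then 2 else 3 := by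
        rw [hornC, codeRec_zero]; simp
      rw [e] at hc
      split_ifs at hc with h
      · exact horn .top (by rw [Form.code, h]) .top (by rw [e, if_pos h])
      · omega
    have hlt : Nat.pair x y < Nat.pair k (Nat.pair x y) := by
      simpa using unpair_two_lt (c := Nat.pair k (Nat.pair x y)) (by simpa using hk0)
    have hx : x < Nat.pair k (Nat.pair x y) := (Nat.left_le_pair x y).trans_lt hlt
    have hy : y < Nat.pair k (Nat.pair x y) := (Nat.right_le_pair x y).trans_lt hlt
    have e := codeRec_pair 3 (fun c r r₁ r₂ =>
      if c.unpair.1 = 0 then if c.unpair.2 = 0 then 2 else 3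
      else if c.unpair.1 = 1 then if c.unpair.2 = 0 then 0 else 3
      else if c.unpair.1 = 2 then if false ∈ (argsOf c).map isTermC then 3 else 1
      else if c.unpair.1 = 3 then if c.unpair.2.unpair.1 = 2 then if r = 1 then 0 else 3 else 3
      else if c.unpair.1 = 4 then if r₁ ≤ 2 ∧ r₂ ≤ 2 then 2 else 3
      else if c.unpair.1 = 5 then if r₁ + r₂ ≤ 1 then r₁ + r₂ else 3
      else if c.unpair.1 = 7 then if r₂ ≤ 2 then 2 else 3
      else if c.unpair.1 = 8 then if r₂ ≤ 2 then 2 else 3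
      else 3) hk0 (Nat.pair x y)
    rw [← hornC] at e
    simp only [Nat.unpair_pair, hk0, if_false] at e
    split_ifs at e with h1 h1b h2 h2b h3 h3a h3b h4 h4b h5 h5b h7 h7b h8 h8b
    · subst h1
      exact clause .bot (by rw [Form.code, h1b]) trivial (by rw [e]; rfl) (by omega)
    · omega
    · omega
    · subst h2
      have hargs : ∀ t ∈ argsOf (Nat.pair 2 (Nat.pair x y)), ∃ u : Trm, termCode u = t := by
        intro t ht
        refine exists_termCode_eq t ?_
        by_contra hf
        rw [Bool.not_eq_true] at hf
        exact h2b (List.mem_map.2 ⟨t, ht, hf⟩)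
      obtain ⟨us, hus⟩ := exists_args_of_forall_exists hargs
      refine clause (.atom _ x us) ?_ trivial (by rw [e]; rfl) (by omega)
      rw [Form.code, argsCode, hus]
      simp [argsOf]
    · subst h3 h3a
      obtain ⟨A, hA, _, hA'⟩ := ih _ hlt (by omega)
      rw [h3b] at hA'
      obtain ⟨hA1, hA2⟩ := hA' le_rfl
      -- Class `1` also contains disjunctions; the tag `2` singles out the atoms.
      obtain ⟨n, p, ts, rfl⟩ : ∃ n p ts, A = .atom n p ts := by
        cases A <;> simp [Form.code, Nat.pair_eq_pair] at hA ⊢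
      exact clause (.neg (.atom n p ts)) (by rw [Form.code, hA]) trivial (by rw [e]; rfl) (by omega)
    · omega
    · omega
    · subst h4
      obtain ⟨A, hA, hA', _⟩ := ih _ hx h4b.1
      obtain ⟨B, hB, hB', _⟩ := ih _ hy h4b.2
      exact horn (.and A B) (by rw [Form.code, hA, hB]) (.and _ _ hA' hB') e
    · omega
    · subst h5
      obtain ⟨A, hA, _, hA'⟩ := ih _ hx (by omega)
      obtain ⟨B, hB, _, hB'⟩ := ih _ hy (by omega)
      obtain ⟨a1, a2⟩ := hA' (by omega)
      obtain ⟨b1, b2⟩ := hB' (by omega)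
      exact clause (.or A B) (by rw [Form.code, hA, hB]) ⟨a1, b1⟩
        (by rw [e, Form.numPos, a2, b2]) (by omega)
    · omega
    · subst h7
      obtain ⟨A, hA, hA', _⟩ := ih _ hy h7b
      exact horn (.all x A) (by rw [Form.code, hA]) (.all _ _ hA') e
    · omega
    · subst h8
      obtain ⟨A, hA, hA', _⟩ := ih _ hy h8b
      exact horn (.ex x A) (by rw [Form.code, hA]) (.ex _ _ hA') e
    · omega
    · omega

/-! ## Deciding expansions -/

/-- The arguments of the evaluation of expansions: the side, the expansion terms and the true atoms,
which are constant in the recursion, and the polarity, the environment and the code. -/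
abbrev EvArg : Type := (Bool × List ℕ × List GAtom) × Bool × List (ℕ × ℕ) × ℕ

/-- The arguments for the recursive calls: for quantifiers the instances of the matrix, and
otherwise candidates for the immediate subformulas in both polarities. -/
def evArgs (x : EvArg) : List EvArg :=
  if x.2.2.2.unpair.1 = 0 then []
  else if x.2.2.2.unpair.1 = (if x.2.1 then 7 else 8) then
    x.1.2.1.map fun u => (x.1, x.2.1, (x.2.2.2.unpair.2.unpair.1, u) :: x.2.2.1,
      x.2.2.2.unpair.2.unpair.2)
  else if x.2.2.2.unpair.1 = (if x.2.1 then 8 else 7) then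
    [(x.1, x.2.1, (x.2.2.2.unpair.2.unpair.1, epsT x.1.1 x.2.1 x.2.2.2.unpair.2.unpair.1
      x.2.2.2.unpair.2.unpair.2 x.2.2.1) :: x.2.2.1, x.2.2.2.unpair.2.unpair.2)]
  else [(x.1, !x.2.1, x.2.2.1, x.2.2.2.unpair.2),
    (x.1, !x.2.1, x.2.2.1, x.2.2.2.unpair.2.unpair.1),
    (x.1, x.2.1, x.2.2.1, x.2.2.2.unpair.2.unpair.1),
    (x.1, x.2.1, x.2.2.1, x.2.2.2.unpair.2.unpair.2)]

theorem evArgs_measure (x : EvArg) : ∀ y ∈ evArgs x, y.2.2.2 < x.2.2.2 := by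
  intro y hy
  by_cases h0 : x.2.2.2.unpair.1 = 0
  · simp [evArgs, h0] at hy
  have := unpair_two_lt h0
  have h1 := Nat.unpair_left_le x.2.2.2.unpair.2
  have h2 := Nat.unpair_right_le x.2.2.2.unpair.2
  rw [evArgs, if_neg h0] at hy
  split_ifs at hy <;>
    simp only [List.mem_map, List.mem_cons, List.not_mem_nil, or_false] at hy
  all_goals first
    | (obtain ⟨u, -, rfl⟩ := hy; exact h2.trans_lt this)
    | (rcases hy with rfl | rfl | rfl | rfl <;> dsimp only <;> omega)

theorem primrec_epsT {α : Type} [Primcodable α] {s e : α → Bool} {x c : α → ℕ}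
    {σ : α → List (ℕ × ℕ)} (hs : Primrec s) (he : Primrec e) (hx : Primrec x) (hc : Primrec c)
    (hσ : Primrec σ) : Primrec fun a => epsT (s a) (e a) (x a) (c a) (σ a) :=
  Primrec₂.natPair.comp (Primrec.const 2) <|
    Primrec₂.natPair.comp ((Primrec.dom_bool Bool.toNat).comp hs) <|
    Primrec₂.natPair.comp ((Primrec.dom_bool Bool.toNat).comp he) <|
    Primrec₂.natPair.comp hx <| Primrec₂.natPair.comp hc (Primrec.encode.comp hσ)

theorem primrec_evArgs : Primrec evArgs := by
  have he : Primrec fun x : EvArg => x.2.1 := Primrec.fst.comp Primrec.snd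
  have hσ : Primrec fun x : EvArg => x.2.2.1 := Primrec.fst.comp (Primrec.snd.comp Primrec.snd)
  have hc : Primrec fun x : EvArg => x.2.2.2 := Primrec.snd.comp (Primrec.snd.comp Primrec.snd)
  have hb := primrec_unpair₂ hc
  have h1 := primrec_unpair₁ hb
  have h2 := primrec_unpair₂ hb
  have ht := primrec_unpair₁ hc
  have hif : ∀ i j : ℕ, Primrec fun x : EvArg => if x.2.1 = true then i else j := fun i j =>
    (Primrec.dom_bool fun e : Bool => if e = true then i else j).comp he
  have mk : ∀ {γ : Type} [Primcodable γ] {p : γ → EvArg} {e : γ → Bool}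
      {σ : γ → List (ℕ × ℕ)} {c : γ → ℕ}, Primrec p → Primrec e → Primrec σ → Primrec c →
      Primrec fun x => (((p x).1, e x, σ x, c x) : EvArg) := fun hp he hσ hc =>
    Primrec.pair (Primrec.fst.comp hp) (Primrec.pair he (Primrec.pair hσ hc))
  have hn := Primrec.not.comp he
  refine primrec_ite_eq 0 ht (Primrec.const []) <|
    Primrec.ite (Primrec.eq.comp ht (hif 7 8)) ?_ <|
    Primrec.ite (Primrec.eq.comp ht (hif 8 7)) ?_ ?_
  · refine Primrec.list_map (Primrec.fst.comp (Primrec.snd.comp Primrec.fst)) (Primrec₂.mk ?_)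
    exact mk Primrec.fst (he.comp Primrec.fst) (Primrec.list_cons.comp
      (Primrec.pair (h1.comp Primrec.fst) Primrec.snd) (hσ.comp Primrec.fst))
      (h2.comp Primrec.fst)
  · have heps := primrec_epsT (Primrec.fst.comp Primrec.fst) he h1 h2 hσ
    exact Primrec.list_cons.comp (mk Primrec.id he (Primrec.list_cons.comp
      (Primrec.pair h1 heps) hσ) h2) (Primrec.const [])
  · exact Primrec.list_cons.comp (mk Primrec.id hn hσ hb) <|
      Primrec.list_cons.comp (mk Primrec.id hn hσ h1) <|
      Primrec.list_cons.comp (mk Primrec.id he hσ h1) <|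
      Primrec.list_cons.comp (mk Primrec.id he hσ h2) (Primrec.const [])

/-- The ground atom for an environment and the code of an atom. -/
def atomC (x : List (ℕ × ℕ) × ℕ) : GAtom :=
  (x.2.unpair.2.unpair.1, (argsOf x.2).map fun t => instC (x.1, t))

theorem atomC_code (σ : List (ℕ × ℕ)) (n p : ℕ) (ts : Fin n → Trm) :
    atomC (σ, (Form.atom n p ts).code) = instAtom σ p ts := by
  simp [atomC, Form.code, argsCode, argsOf_pair, instAtom, List.map_ofFn, Function.comp_def,
    instC_termCode]

theorem primrec_atomC : Primrec atomC :=
  Primrec.pair (primrec_unpair₁ (primrec_unpair₂ Primrec.snd))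
    (Primrec.list_map (primrec_argsOf.comp Primrec.snd)
      (primrec_instC.comp (Primrec.pair (Primrec.fst.comp Primrec.fst) Primrec.snd)).to₂)

/-- Evaluation of an expansion. -/
def evC : EvArg → Bool :=
  boundedRec (fun x => x.2.2.2) evArgs fun x rs =>
    if x.2.2.2.unpair.1 = 0 then true
    else if x.2.2.2.unpair.1 = 1 then false
    else if x.2.2.2.unpair.1 = 2 then decide (atomC x.2.2 ∈ x.1.2.2)
    -- The positions refer to the last list in `evArgs`: `0` and `1` have reversed polarity, `2` and
    -- `3` the same polarity.
    else if x.2.2.2.unpair.1 = 3 then !rs.getD 0 false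
    else if x.2.2.2.unpair.1 = 4 then rs.getD 2 false && rs.getD 3 false
    else if x.2.2.2.unpair.1 = 5 then rs.getD 2 false || rs.getD 3 false
    else if x.2.2.2.unpair.1 = 6 then !rs.getD 1 false || rs.getD 3 false
    else if x.2.2.2.unpair.1 = 7 then !decide (false ∈ rs)
    else decide (true ∈ rs)

theorem evC_code (s : Bool) (U : List ℕ) (L : List GAtom) (A : Form) (e : Bool)
    (σ : List (ℕ × ℕ)) :
    evC ((s, U, L), e, σ, A.code) = true ↔ A.ev s U (fun q => decide (q ∈ L)) e σ := by
  induction A generalizing e σ with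
  | top => rw [evC, boundedRec_eq _ evArgs_measure]; simp [Form.code, Form.ev]
  | bot => rw [evC, boundedRec_eq _ evArgs_measure]; simp [Form.code, Form.ev]
  | atom n p ts =>
    have h := atomC_code σ n p ts
    rw [evC, boundedRec_eq _ evArgs_measure]
    simp only [h, Form.ev]
    simp [Form.code]
  | neg A ih =>
    rw [evC, boundedRec_eq _ evArgs_measure, ← evC]
    cases e <;> simp [Form.code, Form.ev, evArgs, ← ih]
  | and A B ihA ihB | or A B ihA ihB =>
    rw [evC, boundedRec_eq _ evArgs_measure, ← evC]
    cases e <;> simp [Form.code, Form.ev, evArgs, ← ihA, ← ihB]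
  | imp A B ihA ihB =>
    rw [evC, boundedRec_eq _ evArgs_measure, ← evC]
    cases e <;> simp [Form.code, Form.ev, evArgs, ← ihA, ← ihB, imp_iff_not_or]
  | all y A ih =>
    rw [evC, boundedRec_eq _ evArgs_measure, ← evC]
    cases e <;> simp [Form.code, Form.ev, evArgs, ← ih]
  | ex y A ih =>
    rw [evC, boundedRec_eq _ evArgs_measure, ← evC]
    cases e <;> simp [Form.code, Form.ev, evArgs, ← ih]

theorem primrec_evC : Primrec evC := by
  have hc : Primrec fun x : EvArg × List Bool => x.1.2.2.2 :=
    Primrec.snd.comp (Primrec.snd.comp (Primrec.snd.comp Primrec.fst))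
  have ht := primrec_unpair₁ hc
  have hr : ∀ i : ℕ, Primrec fun x : EvArg × List Bool => x.2.getD i false := fun i =>
    (Primrec.list_getD false).comp Primrec.snd (Primrec.const i)
  have hm : ∀ b : Bool, Primrec fun x : EvArg × List Bool => decide (b ∈ x.2) := fun b =>
    primrec_decide_mem (Primrec.const b) Primrec.snd
  refine primrec_boundedRec evArgs_measure (Primrec.snd.comp (Primrec.snd.comp Primrec.snd))
    primrec_evArgs (Primrec₂.mk ?_)
  exact primrec_ite_eq 0 ht (Primrec.const true) <| primrec_ite_eq 1 ht (Primrec.const false) <|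
    primrec_ite_eq 2 ht (primrec_decide_mem
      (primrec_atomC.comp (Primrec.snd.comp (Primrec.snd.comp Primrec.fst)))
      (Primrec.snd.comp (Primrec.snd.comp (Primrec.fst.comp Primrec.fst)))) <|
    primrec_ite_eq 3 ht (Primrec.not.comp (hr 0)) <|
    primrec_ite_eq 4 ht (Primrec.and.comp (hr 2) (hr 3)) <|
    primrec_ite_eq 5 ht (Primrec.or.comp (hr 2) (hr 3)) <|
    primrec_ite_eq 6 ht (Primrec.or.comp (Primrec.not.comp (hr 1)) (hr 3)) <|
    primrec_ite_eq 7 ht (Primrec.not.comp (hm false)) (hm true)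

/-- The atoms of an expansion. -/
def evAtomsC : EvArg → List GAtom :=
  boundedRec (fun x => x.2.2.2) evArgs fun x rs => atomC x.2.2 :: rs.flatten

theorem mem_evAtomsC_of_mem_evArgs {x y : EvArg} (hy : y ∈ evArgs x) {q : GAtom}
    (hq : q ∈ evAtomsC y) : q ∈ evAtomsC x := by
  rw [evAtomsC, boundedRec_eq _ evArgs_measure, ← evAtomsC]
  exact List.mem_cons_of_mem _ (List.mem_flatten.2 ⟨_, List.mem_map.2 ⟨y, hy, rfl⟩, hq⟩)

/-- `evAtomsC` reads every visited code as if it were an atom and so overapproximates. This is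
harmless, as only agreement on the atoms that really occur is needed. -/
theorem Form.ev_congr_evAtomsC (s : Bool) (U : List ℕ) (L : List GAtom) (A : Form)
    {J J' : GAtom → Bool} (e : Bool) (σ : List (ℕ × ℕ))
    (h : ∀ q ∈ evAtomsC ((s, U, L), e, σ, A.code), J q = J' q) :
    A.ev s U J e σ ↔ A.ev s U J' e σ := by
  have sub : ∀ y ∈ evArgs ((s, U, L), e, σ, A.code), ∀ q ∈ evAtomsC y, J q = J' q :=
    fun y hy q hq => h q (mem_evAtomsC_of_mem_evArgs hy hq)
  induction A generalizing e σ with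
  | top | bot => simp [Form.ev]
  | atom n p ts =>
    have := h (instAtom σ p ts) (by
      rw [evAtomsC, boundedRec_eq _ evArgs_measure, atomC_code]; exact List.mem_cons_self)
    simp [Form.ev, this]
  | neg A ih =>
    have hA := sub ((s, U, L), !e, σ, A.code) (by cases e <;> simp [evArgs, Form.code])
    exact not_congr (ih (!e) σ hA fun y hy q hq => hA q (mem_evAtomsC_of_mem_evArgs hy hq))
  | and A B ihA ihB | or A B ihA ihB =>
    have hA := sub ((s, U, L), e, σ, A.code) (by cases e <;> simp [evArgs, Form.code])
    have hB := sub ((s, U, L), e, σ, B.code) (by cases e <;> simp [evArgs, Form.code])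
    have iA := ihA e σ hA fun y hy q hq => hA q (mem_evAtomsC_of_mem_evArgs hy hq)
    have iB := ihB e σ hB fun y hy q hq => hB q (mem_evAtomsC_of_mem_evArgs hy hq)
    simp only [Form.ev, iA, iB]
  | imp A B ihA ihB =>
    have hA := sub ((s, U, L), !e, σ, A.code) (by cases e <;> simp [evArgs, Form.code])
    have hB := sub ((s, U, L), e, σ, B.code) (by cases e <;> simp [evArgs, Form.code])
    have iA := ihA (!e) σ hA fun y hy q hq => hA q (mem_evAtomsC_of_mem_evArgs hy hq)
    have iB := ihB e σ hB fun y hy q hq => hB q (mem_evAtomsC_of_mem_evArgs hy hq)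
    simp only [Form.ev, iA, iB]
  | all x A ih =>
    cases e
    · have hA := sub ((s, U, L), false, (x, epsT s false x A.code σ) :: σ, A.code)
        (by simp [evArgs, Form.code])
      exact ih false _ hA fun y hy q hq => hA q (mem_evAtomsC_of_mem_evArgs hy hq)
    · refine forall₂_congr fun u hu => ?_
      have hA := sub ((s, U, L), true, (x, u) :: σ, A.code) (by simpa [evArgs, Form.code] using hu)
      exact ih true _ hA fun y hy q hq => hA q (mem_evAtomsC_of_mem_evArgs hy hq)
  | ex x A ih =>
    cases e
    · refine exists_congr fun u => and_congr_right fun hu => ?_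
      have hA := sub ((s, U, L), false, (x, u) :: σ, A.code) (by simpa [evArgs, Form.code] using hu)
      exact ih false _ hA fun y hy q hq => hA q (mem_evAtomsC_of_mem_evArgs hy hq)
    · have hA := sub ((s, U, L), true, (x, epsT s true x A.code σ) :: σ, A.code)
        (by simp [evArgs, Form.code])
      exact ih true _ hA fun y hy q hq => hA q (mem_evAtomsC_of_mem_evArgs hy hq)

theorem primrec_evAtomsC : Primrec evAtomsC :=
  primrec_boundedRec evArgs_measure (Primrec.snd.comp (Primrec.snd.comp Primrec.snd))
    primrec_evArgs (Primrec.list_cons.comp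
      (primrec_atomC.comp (Primrec.snd.comp (Primrec.snd.comp Primrec.fst)))
      (Primrec.list_flatten.comp Primrec.snd)).to₂

/-! ## Certificates -/

/-- The expansions over `U` of the formula with code `a` and of the negation of the formula with
code `b` are jointly unsatisfiable. -/
def EntailsC (a b : ℕ) (U : List ℕ) : Prop :=
  ∀ L ∈ List.sublists' (evAtomsC ((true, U, []), true, [], a) ++
      evAtomsC ((false, U, []), false, [], b)),
    evC ((true, U, L), true, [], a) = true → evC ((false, U, L), false, [], b) = true

/-- Herbrand's theorem with the quantifier over valuations replaced by a truth table over the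
finitely many collected atoms. -/
theorem entails_iff_exists_entailsC (A B : Form) :
    Entails A B ↔ ∃ U, EntailsC A.code B.code U := by
  rw [entails_iff_exists_expansion]
  refine exists_congr fun U => ⟨fun h L _ => ?_, fun h J hA => ?_⟩
  · rw [evC_code, evC_code]; exact h _
  -- The row of the truth table that agrees with `J` on the collected atoms.
  · set L := (evAtomsC ((true, U, []), true, [], A.code) ++
      evAtomsC ((false, U, []), false, [], B.code)).filter fun q => J q
    have hL : ∀ q, (q ∈ evAtomsC ((true, U, []), true, [], A.code) ∨
        q ∈ evAtomsC ((false, U, []), false, [], B.code)) → J q = decide (q ∈ L) := by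
      intro q hq
      rw [← List.mem_append] at hq
      cases hJ : J q <;> (simp [L, hJ]; try simpa using hq)
    have := h L (List.mem_sublists'.2 List.filter_sublist)
    rw [evC_code, evC_code, ← A.ev_congr_evAtomsC true U [] true [] fun q hq => hL q (.inl hq),
      ← B.ev_congr_evAtomsC false U [] false [] fun q hq => hL q (.inr hq)] at this
    exact this hA

theorem primrec_entailsC : PrimrecPred fun x : ℕ × ℕ × List ℕ => EntailsC x.1 x.2.1 x.2.2 := by
  have hU : Primrec fun x : ℕ × ℕ × List ℕ => x.2.2 := Primrec.snd.comp Primrec.snd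
  have hb : Primrec fun x : ℕ × ℕ × List ℕ => x.2.1 := Primrec.fst.comp Primrec.snd
  have arg : ∀ {γ : Type} [Primcodable γ] (s e : Bool) {U : γ → List ℕ} {L : γ → List GAtom}
      {c : γ → ℕ}, Primrec U → Primrec L → Primrec c →
      Primrec fun x => (((s, U x, L x), e, [], c x) : EvArg) := fun s e U L c hU hL hc =>
    Primrec.pair (Primrec.pair (Primrec.const s) (Primrec.pair hU hL))
      (Primrec.pair (Primrec.const e) (Primrec.pair (Primrec.const []) hc))
  have hL : Primrec fun x : ℕ × ℕ × List ℕ => List.sublists'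
      (evAtomsC ((true, x.2.2, []), true, [], x.1) ++
        evAtomsC ((false, x.2.2, []), false, [], x.2.1)) :=
    primrec_sublists'.comp (Primrec.list_append.comp
      (primrec_evAtomsC.comp (arg true true hU (Primrec.const []) Primrec.fst))
      (primrec_evAtomsC.comp (arg false false hU (Primrec.const []) hb)))
  have hR : PrimrecRel fun (L : List GAtom) (x : ℕ × ℕ × List ℕ) =>
      evC ((true, x.2.2, L), true, [], x.1) = true →
        evC ((false, x.2.2, L), false, [], x.2.1) = true := by
    have h1 : Primrec fun y : List GAtom × ℕ × ℕ × List ℕ =>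
        evC ((true, y.2.2.2, y.1), true, [], y.2.1) :=
      primrec_evC.comp (arg true true (hU.comp Primrec.snd) Primrec.fst
        (Primrec.fst.comp Primrec.snd))
    have h2 : Primrec fun y : List GAtom × ℕ × ℕ × List ℕ =>
        evC ((false, y.2.2.2, y.1), false, [], y.2.2.1) :=
      primrec_evC.comp (arg false false (hU.comp Primrec.snd) Primrec.fst (hb.comp Primrec.snd))
    have h : PrimrecPred fun y : List GAtom × ℕ × ℕ × List ℕ =>
        evC ((true, y.2.2.2, y.1), true, [], y.2.1) = true →
          evC ((false, y.2.2.2, y.1), false, [], y.2.2.1) = true :=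
      ((Primrec.eq.comp h1 (Primrec.const true)).not.or
        (Primrec.eq.comp h2 (Primrec.const true))).of_eq fun y => imp_iff_not_or.symm
    exact h.primrecRel
  exact hR.forall_mem_list.comp hL Primrec.id

theorem primrecPred_forall_mem {α β : Type} [Primcodable α] [Primcodable β] {f g h : α → List β}
    (hf : Primrec f) (hg : Primrec g) (hh : Primrec h) :
    PrimrecPred fun a => ∀ x ∈ f a, x ∈ g a ∧ x ∈ h a := by
  have hR : PrimrecRel fun (x : β) (a : α) => x ∈ g a ∧ x ∈ h a :=
    ((primrecRel_mem.comp Primrec.fst (hg.comp Primrec.snd)).and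
      (primrecRel_mem.comp Primrec.fst (hh.comp Primrec.snd))).primrecRel
  exact hR.forall_mem_list.comp hf Primrec.id

/-- The triple `d` consists of the code of a Horn formula that is a Craig-Lyndon interpolant for the
formulas with the codes `fg`, and of certificates for the two entailments. -/
def Certifies (fg : ℕ × ℕ) (d : ℕ × List ℕ × List ℕ) : Prop :=
  hornC d.1 ≤ 2 ∧ EntailsC fg.1 d.1 d.2.1 ∧ EntailsC d.1 fg.2 d.2.2 ∧
    (∀ x ∈ funsC d.1, x ∈ funsC fg.1 ∧ x ∈ funsC fg.2) ∧
    (∀ x ∈ predsC d.1, x ∈ predsC fg.1 ∧ x ∈ predsC fg.2) ∧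
    ∀ x ∈ freeVarsC d.1, x ∈ freeVarsC fg.1 ∧ x ∈ freeVarsC fg.2

theorem primrec_certifies :
    PrimrecPred fun y : (ℕ × ℕ) × ℕ × List ℕ × List ℕ => Certifies y.1 y.2 := by
  let Y := (ℕ × ℕ) × ℕ × List ℕ × List ℕ
  have hf : Primrec fun y : Y => y.1.1 := Primrec.fst.comp Primrec.fst
  have hg : Primrec fun y : Y => y.1.2 := Primrec.snd.comp Primrec.fst
  have hh : Primrec fun y : Y => y.2.1 := Primrec.fst.comp Primrec.snd
  have hU : Primrec fun y : Y => y.2.2.1 := Primrec.fst.comp (Primrec.snd.comp Primrec.snd)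
  have hV : Primrec fun y : Y => y.2.2.2 := Primrec.snd.comp (Primrec.snd.comp Primrec.snd)
  exact (Primrec.nat_le.comp (primrec_hornC.comp hh) (Primrec.const 2)).and <|
    (primrec_entailsC.comp (Primrec.pair hf (Primrec.pair hh hU))).and <|
    (primrec_entailsC.comp (Primrec.pair hh (Primrec.pair hg hV))).and <|
    (primrecPred_forall_mem (primrec_funsC.comp hh) (primrec_funsC.comp hf)
      (primrec_funsC.comp hg)).and <|
    (primrecPred_forall_mem (primrec_predsC.comp hh) (primrec_predsC.comp hf)
      (primrec_predsC.comp hg)).and <|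
    primrecPred_forall_mem (primrec_freeVarsC.comp hh) (primrec_freeVarsC.comp hf)
      (primrec_freeVarsC.comp hg)

theorem voc_subset_inter_iff (F G H : Form) : H.voc ⊆ F.voc ∩ G.voc ↔
    H.funs ⊆ F.funs ∩ G.funs ∧ H.predsAt true ⊆ F.predsAt true ∩ G.predsAt true := by
  constructor
  · refine fun h => ⟨fun x hx => ?_, fun x hx => ?_⟩
    · simpa [Form.voc] using h (.inl ⟨x, hx, rfl⟩)
    · simpa [Form.voc] using h (.inr ⟨x, hx, rfl⟩)
  · rintro ⟨h1, h2⟩ _ (⟨x, hx, rfl⟩ | ⟨x, hx, rfl⟩)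
    · exact ⟨.inl ⟨x, (h1 hx).1, rfl⟩, .inl ⟨x, (h1 hx).2, rfl⟩⟩
    · exact ⟨.inr ⟨x, (h2 hx).1, rfl⟩, .inr ⟨x, (h2 hx).2, rfl⟩⟩

/-- Only the entailments need certificates; the conditions on vocabulary and variables are read off
the codes. -/
theorem exists_certifies_iff (F G H : Form) :
    (∃ U V, Certifies (F.code, G.code) (H.code, U, V)) ↔
      hornC H.code ≤ 2 ∧ IsCraigLyndonInterpolant F G H := by
  simp only [Certifies, mem_funsC, mem_predsC, mem_freeVarsC]
  constructor
  · rintro ⟨U, V, h0, hU, hV, h1, h2, h3⟩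
    exact ⟨h0, (entails_iff_exists_entailsC F H).2 ⟨U, hU⟩,
      (entails_iff_exists_entailsC H G).2 ⟨V, hV⟩, (voc_subset_inter_iff F G H).2 ⟨h1, h2⟩, h3⟩
  · rintro ⟨h0, hH⟩
    obtain ⟨U, hU⟩ := (entails_iff_exists_entailsC F H).1 hH.left
    obtain ⟨V, hV⟩ := (entails_iff_exists_entailsC H G).1 hH.right
    have hvoc := (voc_subset_inter_iff F G H).1 hH.voc
    exact ⟨U, V, h0, hU, hV, hvoc.1, hvoc.2, hH.vars⟩

/-! ### Search for a certified interpolant. -/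

open Classical in
/-- Search for a certified Horn interpolant of the formulas whose codes are the first two components
of the input. The third component, the tableau proof, is not consulted: it leaves open which of its
constants stand for the free variables, so that what is extracted from it would need certificates of
the same kind. -/
noncomputable def searchInterpolant (n : ℕ) : Part ℕ :=
  Nat.rfindOpt fun k => (Encodable.decode (α := ℕ × List ℕ × List ℕ) k).bind fun d =>
    if Certifies (n.unpair.1, n.unpair.2.unpair.1) d then some d.1 else none

theorem partrec_searchInterpolant : Nat.Partrec searchInterpolant := by
  classical
  refine Partrec.nat_iff.1 (Partrec.rfindOpt (Primrec₂.to_comp (Primrec₂.mk ?_)))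
  have hn : Primrec fun z : (ℕ × ℕ) × ℕ × List ℕ × List ℕ =>
      ((z.1.1.unpair.1, z.1.1.unpair.2.unpair.1) : ℕ × ℕ) :=
    Primrec.pair (primrec_unpair₁ (Primrec.fst.comp Primrec.fst))
      (primrec_unpair₁ (primrec_unpair₂ (Primrec.fst.comp Primrec.fst)))
  exact Primrec.option_bind (Primrec.decode.comp Primrec.snd) <| Primrec₂.mk <|
    Primrec.ite (primrec_certifies.comp (Primrec.pair hn Primrec.snd))
      (Primrec.option_some.comp (Primrec.fst.comp Primrec.snd)) (Primrec.const none)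

/-- Existence of an interpolant gives termination, and the certificates make whatever is found
correct. -/
theorem Form.IsHorn.exists_code_mem_searchInterpolant {F G : Form} (hF : F.IsHorn)
    (h : Entails F G) (p : ℕ) :
    ∃ H : Form, H.code ∈ searchInterpolant (Nat.pair F.code (Nat.pair G.code p)) ∧
      IsCraigLyndonInterpolant F G H ∧ H.IsHorn := by
  obtain ⟨H₀, hH₀, hHorn⟩ := hF.exists_interpolant h
  obtain ⟨U, V, hc⟩ := (exists_certifies_iff F G H₀).2 ⟨hHorn.hornC_code, hH₀⟩
  have hdom : (searchInterpolant (Nat.pair F.code (Nat.pair G.code p))).Dom := by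
    refine Nat.rfindOpt_dom.2 ⟨Encodable.encode (H₀.code, U, V), H₀.code, ?_⟩
    simp [hc]
  obtain ⟨n, hn⟩ := Part.dom_iff_mem.1 hdom
  obtain ⟨k, hk⟩ := Nat.rfindOpt_spec hn
  simp only [Nat.unpair_pair, Option.mem_def, Option.bind_eq_some_iff] at hk
  obtain ⟨⟨m, U', V'⟩, _, hd⟩ := hk
  split_ifs at hd with hcert
  simp only [Option.some.injEq] at hd
  subst hd
  -- The search returns a mere number; the Horn test guarantees that it is the code of a formula.
  obtain ⟨H, rfl, hH, _⟩ := exists_isHorn_of_hornC m hcert.1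
  exact ⟨H, hn, ((exists_certifies_iff F G H).1 ⟨U', V', by simpa using hcert⟩).2, hH⟩

end HornInterpolation

theorem theorem2 :
    (∀ F G : Form, F.IsHorn → Entails F G →
      ∃ H : Form, IsCraigLyndonInterpolant F G H ∧ H.IsHorn) ∧
    (∃ construct : ℕ →. ℕ, Nat.Partrec construct ∧
      ∀ (F G : Form) (P : TableauProof), F.IsHorn → Entails F G → P.Proves F G →
        ∃ H : Form, H.code ∈ construct (Nat.pair F.code (Nat.pair G.code P.code)) ∧
          IsCraigLyndonInterpolant F G H ∧ H.IsHorn) :=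
  ⟨fun _ _ hF h => hF.exists_interpolant h, searchInterpolant, partrec_searchInterpolant,
    fun _ _ P hF h _ => hF.exists_code_mem_searchInterpolant h P.code⟩
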